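/- Consider the $k$-armed stochastic bandit over $T$ rounds with unit switching costs and switching budget $S$. An environment $\mathcal D=(\mathcal D_1,\dots,\mathcal D_k)$ consists of standardized (variance proxy $1$) sub-Gaussian reward distributions on $\mathbb R$ with means $\mu_1,\dots,\mu_k$ such that $|\mu_i-\mu_j|\le 1$ for all $i,j$; rewards of action $i$ are drawn i.i.d. from $\mathcal D_i$. A (randomized) policy $\pi$ selects the action $\pi_t\in\{1,\dots,k\}$ of round $t$ through a probability kernel from the past actions and observed rewards. Let $\Pi_S$ be the set of policies that, in every environment, almost surely make at most $S$ switches, i.e. $\sum_{t=1}^{T-1}\mathbf 1[\pi_t\ne\pi_{t+1}]\le S$, and let $$R^*_S(T)=\inf_{\pi\in\Pi_S}\ \sup_{\mathcal D}\Big\{T\max_i\mu_i-\mathbb E^{\pi}_{\mathcal D}\Big[\sum_{t=1}^T\mu_{\pi_t}\Big]\Big\}.$$ Then for every fixed $k\ge 2$ and every integer $S\ge 1$, $$R^*_S(T)=\tilde\Theta\Big(T^{1/(2-2^{-m(S)})}\Big),\qquad m(S)=\Big\lfloor\frac{S-1}{k-1}\Big\rfloor,$$ that is: for every $k\ge2$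 there are constants $c,C>0$ and $p\in\mathbb N$, depending only on $k$, such that for all integers $S\ge 1$ and $T\ge k$, $$c\,\frac{T^{1/(2-2^{-m(S)})}}{(\log T)^{p}}\ \le\ R^*_S(T)\ \le\ C\,T^{1/(2-2^{-m(S)})}(\log T)^{p}.$$ -/

import Mathlib

open MeasureTheory ProbabilityTheory
open scoped ENNReal

namespace BwSC

/-- The history of the first `n` rounds of a `k`-armed bandit: the chosen action and the observed
reward of each round. -/
abbrev History (k n : ℕ) : Type := Fin n → Fin k × ℝ

/-- An environment `𝒟 = (𝒟₁, …, 𝒟ₖ)`: one reward distribution per action, each standardized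
sub-Gaussian (i.e. `𝔼 exp (s (X - 𝔼 X)) ≤ exp (s² / 2)` for all real `s`), whose expected values
differ pairwise by at most `1`. -/
structure Environment (k : ℕ) where
  /-- The reward distribution of each action. -/
  law : Fin k → Measure ℝ
  isProbabilityMeasure_law : ∀ i, IsProbabilityMeasure (law i)
  subgaussian : ∀ i, HasSubgaussianMGF (fun x ↦ x - ∫ y, y ∂(law i)) 1 (law i)
  gap_le_one : ∀ i j, |(∫ y, y ∂(law i)) - ∫ y, y ∂(law j)| ≤ 1

attribute [instance] Environment.isProbabilityMeasure_law

/-- The expected reward `μ_i` of action `i`. -/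
noncomputable def Environment.mean {k : ℕ} (D : Environment k) (i : Fin k) : ℝ :=
  ∫ y, y ∂(D.law i)

/-- A (randomized, non-anticipating) policy: for each `n`, a probability kernel from the history of
the first `n` rounds to the action chosen in the next round. Over a horizon of `T` rounds only the
kernels with `n < T` are used. -/
structure Policy (k : ℕ) where
  /-- The kernel which selects the action that follows a history of length `n`. -/
  kernel : (n : ℕ) → Kernel (History k n) (Fin k)
  isMarkovKernel_kernel : ∀ n, IsMarkovKernel (kernel n)

attribute [instance] Policy.isMarkovKernel_kernel

/-- The reward kernel: playing action `i` yields a reward drawn from `𝒟_i`. -/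
noncomputable def Environment.rewardKernel {k : ℕ} (D : Environment k) : Kernel (Fin k) ℝ :=
  Kernel.ofFunOfCountable D.law

instance {k : ℕ} (D : Environment k) : IsMarkovKernel D.rewardKernel :=
  ⟨fun i ↦ D.isProbabilityMeasure_law i⟩

/-- One round of interaction: given the history, the policy draws an action, and then, given that
action only, the environment draws the reward. -/
noncomputable def stepKernel {k : ℕ} (π : Policy k) (D : Environment k) (n : ℕ) :
    Kernel (History k n) (Fin k × ℝ) :=
  (π.kernel n) ⊗ₖ (Kernel.prodMkLeft (History k n) D.rewardKernel)

instance {k : ℕ} (π : Policy k) (D : Environment k) (n : ℕ) :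
    IsMarkovKernel (stepKernel π D n) := by
  unfold stepKernel; infer_instance

/-- The probability measure `ℙ_𝒟^π` on the histories of `T` rounds. -/
noncomputable def historyMeasure {k : ℕ} (π : Policy k) (D : Environment k) :
    (T : ℕ) → Measure (History k T)
  | 0 => Measure.dirac Fin.elim0
  | n + 1 => ((historyMeasure π D n) ⊗ₘ (stepKernel π D n)).map
      (fun p ↦ (Fin.snoc p.1 p.2 : History k (n + 1)))

/-- Appending a round to a history is measurable, so that the image measure in `historyMeasure` is
the genuine one. -/
theorem measurable_snoc (k n : ℕ) :
    Measurable (fun p : History k n × (Fin k × ℝ) ↦ (Fin.snoc p.1 p.2 : History k (n + 1))) := by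
  refine measurable_pi_iff.2 fun i ↦ ?_
  refine Fin.lastCases ?_ (fun j ↦ ?_) i
  · simpa using measurable_snd
  · simp only [Fin.snoc_castSucc]
    exact (measurable_pi_apply j).comp measurable_fst

instance {k : ℕ} (π : Policy k) (D : Environment k) (T : ℕ) :
    IsProbabilityMeasure (historyMeasure π D T) := by
  induction T with
  | zero => unfold historyMeasure; infer_instance
  | succ n ih =>
    unfold historyMeasure
    exact Measure.isProbabilityMeasure_map (measurable_snoc k n).aemeasurable

/-- The total switching cost `∑_{t=1}^{T-1} c(π_t, π_{t+1})` of a sequence of actions. -/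
noncomputable def totalSwitchingCost {k T : ℕ} (c : Fin k → Fin k → ℝ≥0∞) (a : Fin T → Fin k) :
    ℝ≥0∞ :=
  ∑ t : Fin (T - 1), c (a ⟨t, by omega⟩) (a ⟨t + 1, by omega⟩)

/-- Unit switching costs: each switch between two different actions costs `1`. -/
noncomputable def unitCost (k : ℕ) (i j : Fin k) : ℝ≥0∞ := if i = j then 0 else 1

/-- `π` is an `S`-switching-budget policy for the horizon `T`: in every environment, its total
switching cost over the `T` rounds is almost surely at most `S`. -/
def IsBudgetPolicy {k : ℕ} (c : Fin k → Fin k → ℝ≥0∞) (S : ℝ≥0∞) (T : ℕ) (π : Policy k) : Prop :=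
  ∀ D : Environment k, ∀ᵐ h ∂(historyMeasure π D T), totalSwitchingCost c (fun t ↦ (h t).1) ≤ S

/-- The regret `T μ* - 𝔼_𝒟^π [∑_{t=1}^T μ_{π_t}]` of `π` in the environment `𝒟`. -/
noncomputable def regretIn {k : ℕ} (π : Policy k) (D : Environment k) (T : ℕ) : ℝ :=
  T * (⨆ i, D.mean i) - ∫ h, ∑ t : Fin T, D.mean (h t).1 ∂(historyMeasure π D T)

/-- The regret in an environment lies in `[0, T]`, so the supremum and the infimum below are taken
over bounded sets of reals. -/
theorem regretIn_mem_Icc {k : ℕ} (hk : k ≠ 0) (π : Policy k) (D : Environment k) (T : ℕ) :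
    regretIn π D T ∈ Set.Icc (0 : ℝ) T := by
  have : NeZero k := ⟨hk⟩
  have hb : BddAbove (Set.range D.mean) := (Set.finite_range _).bddAbove
  have hup : ∀ i, D.mean i ≤ ⨆ i, D.mean i := fun i ↦ le_ciSup hb i
  have hlo : ∀ i, (⨆ i, D.mean i) - 1 ≤ D.mean i := fun i ↦ by
    have : (⨆ i, D.mean i) ≤ D.mean i + 1 := ciSup_le fun j ↦ by
      have := (abs_le.1 (D.gap_le_one j i)).2
      simp only [Environment.mean]
      linarith
    linarith
  have hm : Measurable (fun h : History k T ↦ ∑ t : Fin T, D.mean (h t).1) :=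
    Finset.measurable_sum _ fun t _ ↦ (measurable_of_countable D.mean).comp
      (measurable_fst.comp (measurable_pi_apply t))
  have h1 : ∀ h : History k T, ∑ t : Fin T, D.mean (h t).1 ≤ T * (⨆ i, D.mean i) := fun h ↦ by
    simpa using Finset.sum_le_card_nsmul Finset.univ (fun t ↦ D.mean (h t).1) _
      (fun t _ ↦ hup (h t).1)
  have h2 : ∀ h : History k T, T * ((⨆ i, D.mean i) - 1) ≤ ∑ t : Fin T, D.mean (h t).1 :=
    fun h ↦ by
      simpa using Finset.card_nsmul_le_sum Finset.univ (fun t ↦ D.mean (h t).1) _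
        (fun t _ ↦ hlo (h t).1)
  have hi : Integrable (fun h : History k T ↦ ∑ t : Fin T, D.mean (h t).1)
      (historyMeasure π D T) :=
    Integrable.of_mem_Icc _ _ hm.aemeasurable (Filter.Eventually.of_forall fun h ↦ ⟨h2 h, h1 h⟩)
  have h3 := integral_mono hi (integrable_const _) h1
  have h4 := integral_mono (integrable_const _) hi h2
  simp only [integral_const, probReal_univ, one_smul] at h3 h4
  unfold regretIn
  constructor <;> linarith

/-- The worst-case regret `R^π(T) = sup_𝒟 {T μ* - 𝔼_𝒟^π [∑_{t=1}^T μ_{π_t}]}`. -/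
noncomputable def regret {k : ℕ} (π : Policy k) (T : ℕ) : ℝ :=
  ⨆ D : Environment k, regretIn π D T

/-- The minimax regret `R*_S(T) = inf_{π ∈ Π_S} R^π(T)` of the bandit problem with switching costs
`c` and switching budget `S`. -/
noncomputable def minimaxRegret {k : ℕ} (c : Fin k → Fin k → ℝ≥0∞) (S : ℝ≥0∞) (T : ℕ) : ℝ :=
  ⨅ π : {π : Policy k // IsBudgetPolicy c S T π}, regret π.1 T

/-- `m(S) = ⌊(S - 1) / (k - 1)⌋`. -/
noncomputable def phaseIndex (k S : ℕ) : ℕ := ⌊((S : ℝ) - 1) / ((k : ℝ) - 1)⌋₊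

/-- The exponent `1 / (2 - 2 ^ (-m(S)))`. -/
noncomputable def regretExponent (k S : ℕ) : ℝ := 1 / (2 - (2 : ℝ) ^ (-(phaseIndex k S : ℝ)))

end BwSC

/-!
The exponent comes from a recursion. Playing an action `n` times determines its mean up to `1 / √n`,
so if `R` is the regret one is ready to pay, then `n` samples of each action allow a next period of
length about `R √n`. Starting from `R` rounds, `m` such periods reach the horizon `T` when
`R ^ (2 - 2 ^ (-m)) = T`. A period in which all `k` actions are sampled costs `k - 1` switches, since
it may start with the action on which the previous one ended; hence `m = ⌊(S - 1) / (k - 1)⌋`, one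
switch being left to move to the final action.

*Upper bound.* Successive elimination in `m` epochs of `k` blocks each, followed by a commitment to
one surviving action (`eliminationPolicy`). If the last action played does not survive an epoch, then
some slot of the next epoch is free, and the actions are assigned to slots in such a way that the
first two agree (`exists_next_schedule`); so an epoch costs `k - 1` switches on every path
(`numSwitches_blocks_le`). Sums of the noise over fixed sets of rounds are sub-Gaussian under every
policy (`lintegral_exp_sum_noise_le`), so the confidence intervals hold up to probability
`O(m k / T²)`, and the regret is `O(k (m + 1) R log T)`. Nothing requires the epochs to fit
into the horizon: the policy is simply cut off at `T`.

*Lower bound.* The covering process (`cover`) counts how often all `k` actions have been played anew,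
and each cover costs `k - 1` switches. Fix a time grid `τ` whose cell starting at `t` has length about
`r √t` (`grid`), where `r` is `R` up to a polynomial in `m`. In the environment in which all actions
are alike, one of `(m + 2) k` events has probability at least `1 / ((m + 2) k)`
(`exists_absent_or_le_cover`, `exists_coversWith`):
* some action is absent from a cell `[u, v)`. It has been sampled at most `u` times by round `v`, and
  might be better than the others by `1 / √u` (`regret_ge_of_absent`);
* some action completes cover number `m + 1` before `τ (m + 1) ≤ T / 2`, cover number `m` having been
  completed by `τ m`. The budget is then exhausted, so this action is played forever, although it has
  been sampled at most `τ m + 1` times and might be worse than the others by `1 / √(τ m + 1)`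
  (`regret_ge_of_coversWith`).

The transfer between the environments is `sq_lintegral_le_changeWeight`, a Cauchy–Schwarz (`χ²`)
bound proved by induction on the number of rounds: the squared mean of a functional of the history in
one environment is at most its second moment in the other, weighted by one factor per sample of the
perturbed action. In the second event the samples taken after the completion of the cover must not
count, which is why the bound is stated for functionals that are determined at a stopping time.

The losses polynomial in `m` are logarithmic in `T` as long as `2 ^ m < log₂ T`. For larger `m` the
rate is `√T` up to a constant; the lower bound then holds for any policy (`sqrt_le_regret`), and the
upper bound is attained with fewer epochs.
-/

open MeasureTheory ProbabilityTheory
open scoped ENNReal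

namespace BwSC

/-! ### Integration over histories -/

theorem lintegral_stepKernel {k n : ℕ} (π : Policy k) (D : Environment k) (h : History k n)
    {f : Fin k × ℝ → ℝ≥0∞} (hf : Measurable f) :
    ∫⁻ z, f z ∂(stepKernel π D n h) = ∫⁻ a, ∫⁻ x, f (a, x) ∂(D.law a) ∂(π.kernel n h) := by
  unfold stepKernel
  rw [Kernel.lintegral_compProd _ _ _ hf]
  rfl

theorem lintegral_historyMeasure_succ {k n : ℕ} (π : Policy k) (D : Environment k)
    {f : History k (n + 1) → ℝ≥0∞} (hf : Measurable f) :
    ∫⁻ h, f h ∂(historyMeasure π D (n + 1)) =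
      ∫⁻ h, ∫⁻ z, f (Fin.snoc h z) ∂(stepKernel π D n h) ∂(historyMeasure π D n) := by
  rw [historyMeasure, lintegral_map hf (measurable_snoc k n),
    Measure.lintegral_compProd (f := fun p ↦ f (Fin.snoc p.1 p.2))
      (hf.comp (measurable_snoc k n))]

/-- A history of `n` rounds read as an infinite sequence; the rounds that have not been played
hold a default value. -/
noncomputable def extend {k n : ℕ} [NeZero k] (h : History k n) (t : ℕ) : Fin k × ℝ :=
  if ht : t < n then h ⟨t, ht⟩ else (0, 0)

/-- The actions of a history, read as an infinite sequence. -/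
noncomputable def actions {k n : ℕ} [NeZero k] (h : History k n) (t : ℕ) : Fin k := (extend h t).1

theorem mean_le_iSup {k : ℕ} (D : Environment k) (i : Fin k) : D.mean i ≤ ⨆ i, D.mean i :=
  le_ciSup (Set.finite_range D.mean).bddAbove i

theorem sum_gap_nonneg {k : ℕ} (D : Environment k) (a : ℕ → Fin k) (T : ℕ) :
    0 ≤ ∑ t ∈ Finset.range T, ((⨆ i, D.mean i) - D.mean (a t)) :=
  Finset.sum_nonneg fun _ _ ↦ sub_nonneg.2 (mean_le_iSup D _)

section

variable {k : ℕ} [NeZero k]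

theorem extend_fin {n : ℕ} (h : History k n) (t : Fin n) : extend h t = h t := by
  simp [extend]

theorem extend_snoc_of_lt {n : ℕ} (h : History k n) (z : Fin k × ℝ) {t : ℕ} (ht : t < n) :
    extend (Fin.snoc h z : History k (n + 1)) t = extend h t := by
  have h1 : t < n + 1 := by omega
  simp only [extend, ht, h1, dif_pos]
  exact Fin.snoc_castSucc (α := fun _ ↦ Fin k × ℝ) z h ⟨t, ht⟩

theorem extend_snoc_self {n : ℕ} (h : History k n) (z : Fin k × ℝ) :
    extend (Fin.snoc h z : History k (n + 1)) n = z := by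
  simp only [extend, Nat.lt_succ_self, dif_pos]
  exact Fin.snoc_last (α := fun _ ↦ Fin k × ℝ) z h

theorem measurable_extend (n : ℕ) : Measurable (extend : History k n → ℕ → Fin k × ℝ) := by
  refine measurable_pi_iff.2 fun t ↦ ?_
  by_cases ht : t < n
  · simp only [extend, ht, dif_pos]
    exact measurable_pi_apply _
  · simp only [extend, ht, dif_neg, not_false_eq_true]
    exact measurable_const

theorem measurableSet_setOf_actions {n : ℕ} (P : (ℕ → Fin k) → Prop) :
    MeasurableSet {h : History k n | P (actions h)} := by
  have h1 : Measurable (fun h : History k n ↦ fun i : Fin n ↦ (h i).1) :=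
    measurable_pi_iff.2 fun i ↦ measurable_fst.comp (measurable_pi_apply i)
  have h2 : MeasurableSet {b : Fin n → Fin k | P fun t ↦ if ht : t < n then b ⟨t, ht⟩ else 0} :=
    (Set.toFinite _).measurableSet
  have h3 := h1 h2
  convert h3 using 1
  ext h
  simp only [Set.mem_ofPred_eq, Set.mem_preimage]
  have : actions h = fun t ↦ if ht : t < n then (h ⟨t, ht⟩).1 else 0 := by
    funext t
    unfold actions extend
    split <;> rfl
  rw [this]

theorem regretIn_eq_integral (π : Policy k) (D : Environment k) (T : ℕ) :
    regretIn π D T =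
      ∫ h, ∑ t ∈ Finset.range T, ((⨆ i, D.mean i) - D.mean (actions h t))
        ∂(historyMeasure π D T) := by
  have hi : Integrable (fun h : History k T ↦ ∑ t : Fin T, D.mean (h t).1)
      (historyMeasure π D T) := by
    refine integrable_finsetSum _ fun t _ ↦ ?_
    obtain ⟨C, hC⟩ := (Set.finite_range fun i ↦ ‖D.mean i‖).bddAbove
    refine Integrable.of_bound (C := C) ?_ (.of_forall fun h ↦ hC ⟨(h t).1, rfl⟩)
    exact ((measurable_of_countable D.mean).comp
      (measurable_fst.comp (measurable_pi_apply t))).aestronglyMeasurable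
  have h1 : ∀ h : History k T, ∑ t ∈ Finset.range T, ((⨆ i, D.mean i) - D.mean (actions h t)) =
      T * (⨆ i, D.mean i) - ∑ t : Fin T, D.mean (h t).1 := fun h ↦ by
    rw [Finset.sum_sub_distrib, ← Fin.sum_univ_eq_sum_range]
    simp [actions, extend_fin, ← Fin.sum_univ_eq_sum_range (fun t ↦ D.mean (extend h t).1)]
  simp only [h1, regretIn]
  rw [integral_sub (integrable_const _) hi]
  simp

theorem iSup_mean_sub_le_one (D : Environment k) (i : Fin k) : (⨆ i, D.mean i) - D.mean i ≤ 1 := by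
  have : (⨆ i, D.mean i) ≤ D.mean i + 1 := ciSup_le fun j ↦ by
    have := (abs_le.1 (D.gap_le_one j i)).2
    simp only [Environment.mean]
    linarith
  linarith

theorem measurable_sum_gap (D : Environment k) (T : ℕ) : Measurable fun h : History k T ↦
    ∑ t ∈ Finset.range T, ((⨆ i, D.mean i) - D.mean (actions h t)) := by
  refine Finset.measurable_sum _ fun t _ ↦ measurable_const.sub ?_
  exact (measurable_of_countable D.mean).comp (measurable_fst.comp
    ((measurable_pi_apply t).comp (measurable_extend T)))

theorem sum_gap_le (D : Environment k) (a : ℕ → Fin k) (T : ℕ) :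
    ∑ t ∈ Finset.range T, ((⨆ i, D.mean i) - D.mean (a t)) ≤ T := by
  simpa using Finset.sum_le_card_nsmul (Finset.range T) _ 1
    (fun t _ ↦ iSup_mean_sub_le_one D (a t))

/-! ### Change of measure along adaptively collected data -/

theorem sq_lintegral_le {α : Type*} [MeasurableSpace α] (μ : Measure α) [IsProbabilityMeasure μ]
    {f : α → ℝ≥0∞} (hf : Measurable f) : (∫⁻ x, f x ∂μ) ^ 2 ≤ ∫⁻ x, f x ^ 2 ∂μ := by
  have h := ENNReal.lintegral_mul_le_Lp_mul_Lq μ Real.HolderConjugate.two_two hf.aemeasurable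
    (aemeasurable_const (b := (1 : ℝ≥0∞)))
  simp only [Pi.mul_apply, mul_one, ENNReal.one_rpow, lintegral_const, measure_univ,
    ENNReal.rpow_two, one_pow] at h
  calc (∫⁻ x, f x ∂μ) ^ 2 ≤ ((∫⁻ x, f x ^ 2 ∂μ) ^ (1 / 2 : ℝ)) ^ 2 := by gcongr
    _ = ∫⁻ x, f x ^ 2 ∂μ := by
      rw [← ENNReal.rpow_two, ← ENNReal.rpow_mul]; norm_num

/-- The second-moment cost of replacing one environment by another along a history: each round
`t` at which the data are still relevant, in the sense of `A t`, contributes the factor `w a` of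
the action `a` played in it. -/
noncomputable def changeWeight (A : ℕ → (ℕ → Fin k) → Prop) (w : Fin k → ℝ≥0∞) (n : ℕ)
    (a : ℕ → Fin k) : ℝ≥0∞ :=
  open scoped Classical in ∏ t ∈ Finset.range n, if A t a then w (a t) else 1

/-- Change of measure for adaptively collected data. If `w a` bounds the second moment of the
density of the law of arm `a` in `D₀` with respect to its law in `D₁`, then a functional `f` of the
history is controlled in mean under `D₀` by its second moment under `D₁`, at the price of one
factor `w a` per round in which the history is still relevant. Rounds after the first time `j` with
`¬ A j` are free, since `f` is determined by the first `j` rounds. -/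
theorem sq_lintegral_le_changeWeight (π : Policy k) (D₀ D₁ : Environment k) (w : Fin k → ℝ≥0∞)
    (hw : ∀ a, ∀ g : ℝ → ℝ≥0∞, Measurable g →
      (∫⁻ x, g x ∂(D₀.law a)) ^ 2 ≤ w a * ∫⁻ x, g x ^ 2 ∂(D₁.law a))
    (A : ℕ → (ℕ → Fin k) → Prop)
    (hA : ∀ t a a', (∀ s < t, a s = a' s) → A t a → A t a')
    (n : ℕ) (f : History k n → ℝ≥0∞) (hf : Measurable f)
    (hdet : ∀ j ≤ n, ∀ h h' : History k n, (∀ t < j, extend h t = extend h' t) →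
      ¬ A j (actions h) → f h = f h') :
    (∫⁻ h, f h ∂(historyMeasure π D₀ n)) ^ 2 ≤
      ∫⁻ h, f h ^ 2 * changeWeight A w n (actions h) ∂(historyMeasure π D₁ n) := by
  classical
  induction n with
  | zero =>
    have hm : Measurable fun h : History k 0 ↦ f h ^ 2 * changeWeight A w 0 (actions h) := by
      simpa [changeWeight] using hf.pow_const 2
    simp only [historyMeasure]
    rw [lintegral_dirac' _ hf, lintegral_dirac' _ hm]
    simp [changeWeight]
  | succ n ih =>
    have hsn := measurable_snoc k n
    have hWm : Measurable fun h : History k (n + 1) ↦ changeWeight A w (n + 1) (actions h) := by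
      unfold changeWeight
      refine Finset.measurable_prod _ fun t _ ↦ Measurable.ite
        (measurableSet_setOf_actions (fun a ↦ A t a)) ?_ measurable_const
      exact (measurable_of_countable w).comp (measurable_fst.comp
        ((measurable_pi_apply t).comp (measurable_extend (n + 1))))
    have hact : ∀ (h : History k n) (z : Fin k × ℝ), ∀ t < n,
        actions (Fin.snoc h z : History k (n + 1)) t = actions h t := fun h z t ht ↦ by
      rw [actions, extend_snoc_of_lt h z ht, actions]
    have hAs : ∀ t ≤ n, ∀ (h : History k n) (z : Fin k × ℝ),
        A t (actions (Fin.snoc h z : History k (n + 1))) ↔ A t (actions h) := fun t ht h z ↦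
      ⟨hA t _ _ fun s hs ↦ hact h z s (by omega),
        hA t _ _ fun s hs ↦ (hact h z s (by omega)).symm⟩
    have hWs : ∀ (h : History k n) (z : Fin k × ℝ),
        changeWeight A w (n + 1) (actions (Fin.snoc h z : History k (n + 1))) =
          changeWeight A w n (actions h) * if A n (actions h) then w z.1 else 1 := fun h z ↦ by
      unfold changeWeight
      rw [Finset.prod_range_succ]
      congr 1
      · refine Finset.prod_congr rfl fun t ht ↦ ?_
        rw [Finset.mem_range] at ht
        simp only [hAs t ht.le h z, hact h z t ht]
      · have h1 : actions (Fin.snoc h z : History k (n + 1)) n = z.1 := by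
          rw [actions, extend_snoc_self]
        simp only [hAs n le_rfl h z, h1]
    -- `g` is the conditional mean of `f` under `D₀` given the first `n` rounds; it inherits from `f`
    -- the property of being determined at the stopping time.
    set g : History k n → ℝ≥0∞ := fun h ↦ ∫⁻ z, f (Fin.snoc h z) ∂(stepKernel π D₀ n h) with hg
    have hgm : Measurable g := (hf.comp hsn).lintegral_kernel_prod_right'
    have hgdet : ∀ j ≤ n, ∀ h h' : History k n, (∀ t < j, extend h t = extend h' t) →
        ¬ A j (actions h) → g h = g h' := by
      intro j hj h h' hhh' hAj
      have h1 : ∀ z z', f (Fin.snoc h z) = f (Fin.snoc h' z') := fun z z' ↦ by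
        refine hdet j (by omega) _ _ (fun t ht ↦ ?_) (by rwa [hAs j hj])
        rw [extend_snoc_of_lt _ _ (by omega), extend_snoc_of_lt _ _ (by omega), hhh' t ht]
      simp only [hg]
      simp_rw [fun z ↦ h1 z (0, 0), fun z ↦ (h1 (0, 0) z).symm]
      simp [h1 (0, 0) (0, 0)]
    rw [lintegral_historyMeasure_succ π D₀ hf,
      lintegral_historyMeasure_succ π D₁
        (f := fun h ↦ f h ^ 2 * changeWeight A w (n + 1) (actions h)) ((hf.pow_const 2).mul hWm)]
    refine (ih g hgm hgdet).trans (lintegral_mono fun h ↦ ?_)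
    have hfh : Measurable fun z ↦ f (Fin.snoc h z) := hf.comp (hsn.comp measurable_prodMk_left)
    simp only [hWs]
    -- Cauchy–Schwarz, first over the draw of the action, which is the same in both environments, and
    -- then over the reward. After stopping, `f` does not depend on the new round at all.
    have hkey : g h ^ 2 ≤ ∫⁻ z, f (Fin.snoc h z) ^ 2 * (if A n (actions h) then w z.1 else 1)
        ∂(stepKernel π D₁ n h) := by
      by_cases hAn : A n (actions h)
      · simp only [hAn, if_true]
        rw [hg, lintegral_stepKernel π D₁ h (f := fun z ↦ f (Fin.snoc h z) ^ 2 * w z.1)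
          ((hfh.pow_const 2).mul ((measurable_of_countable w).comp measurable_fst))]
        simp only
        rw [lintegral_stepKernel π D₀ h hfh]
        have hm : ∀ (φ : Fin k → ℝ≥0∞), Measurable φ := fun φ ↦ measurable_of_countable φ
        refine (sq_lintegral_le _ (hm _)).trans (lintegral_mono fun a ↦ ?_)
        have hfa : Measurable fun x ↦ f (Fin.snoc h (a, x)) := hfh.comp measurable_prodMk_left
        refine (hw a _ hfa).trans (le_of_eq ?_)
        rw [lintegral_mul_const _ (hfa.pow_const 2), mul_comm]
      · simp only [hAn, if_false, mul_one]
        have h1 : ∀ z, f (Fin.snoc h z) = f (Fin.snoc h (0, 0)) := fun z ↦ by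
          refine hdet n (by omega) _ _ (fun t ht ↦ ?_) (by rwa [hAs n le_rfl])
          rw [extend_snoc_of_lt _ _ ht, extend_snoc_of_lt _ _ ht]
        simp only [hg, h1]
        simp
    calc g h ^ 2 * changeWeight A w n (actions h)
        ≤ (∫⁻ z, f (Fin.snoc h z) ^ 2 * (if A n (actions h) then w z.1 else 1)
          ∂(stepKernel π D₁ n h)) * changeWeight A w n (actions h) := by gcongr
      _ = ∫⁻ z, f (Fin.snoc h z) ^ 2 * (if A n (actions h) then w z.1 else 1) *
          changeWeight A w n (actions h) ∂(stepKernel π D₁ n h) := by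
        rw [lintegral_mul_const]
        refine (hfh.pow_const 2).mul ?_
        split
        · exact (measurable_of_countable w).comp measurable_fst
        · exact measurable_const
      _ = _ := by
        refine lintegral_congr fun z ↦ ?_
        rw [mul_assoc, mul_comm (ite _ _ _)]

end

/-! ### Environments with rewards `±1` -/

/-- The law on `{1, -1}` with expected value `v`. -/
noncomputable def signLaw (v : ℝ) : Measure ℝ :=
  ENNReal.ofReal ((1 + v) / 2) • Measure.dirac 1 + ENNReal.ofReal ((1 - v) / 2) • Measure.dirac (-1)

theorem lintegral_signLaw (v : ℝ) {f : ℝ → ℝ≥0∞} (hf : Measurable f) :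
    ∫⁻ x, f x ∂(signLaw v) =
      ENNReal.ofReal ((1 + v) / 2) * f 1 + ENNReal.ofReal ((1 - v) / 2) * f (-1) := by
  simp [signLaw, lintegral_dirac' _ hf]

theorem isProbabilityMeasure_signLaw {v : ℝ} (hv : |v| ≤ 1) :
    IsProbabilityMeasure (signLaw v) := by
  obtain ⟨h1, h2⟩ := abs_le.1 hv
  constructor
  simp only [signLaw, Measure.coe_add, Measure.coe_smul, Pi.add_apply, Pi.smul_apply, measure_univ,
    smul_eq_mul, mul_one]
  rw [← ENNReal.ofReal_add (by linarith) (by linarith)]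
  ring_nf
  simp

theorem integral_signLaw {v : ℝ} (hv : |v| ≤ 1) : ∫ x, x ∂(signLaw v) = v := by
  obtain ⟨h1, h2⟩ := abs_le.1 hv
  have hi : ∀ (x : ℝ) (c : ℝ), Integrable (fun y : ℝ ↦ y) (ENNReal.ofReal c • Measure.dirac x) :=
    fun x c ↦ (integrable_dirac (by simp)).smul_measure ENNReal.ofReal_ne_top
  rw [signLaw, integral_add_measure (hi _ _) (hi _ _), integral_smul_measure,
    integral_smul_measure, integral_dirac, integral_dirac, ENNReal.toReal_ofReal (by linarith),
    ENNReal.toReal_ofReal (by linarith)]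
  simp only [smul_eq_mul]
  ring

/-- The environment whose action `i` yields rewards `±1` with expected value `v i`. -/
noncomputable def signEnvironment {k : ℕ} (v : Fin k → ℝ) (hv : ∀ i, |v i| ≤ 1 / 2) :
    Environment k where
  law i := signLaw (v i)
  isProbabilityMeasure_law i := isProbabilityMeasure_signLaw ((hv i).trans (by norm_num))
  subgaussian i := by
    have := isProbabilityMeasure_signLaw (v := v i) ((hv i).trans (by norm_num))
    have h := hasSubgaussianMGF_of_mem_Icc (μ := signLaw (v i)) (X := fun x ↦ x) (a := -1) (b := 1)
      aemeasurable_id' (by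
        rw [ae_iff]
        simp [signLaw])
    convert h using 1
    ext
    simp
    norm_num
  gap_le_one i j := by
    rw [integral_signLaw ((hv i).trans (by norm_num)), integral_signLaw ((hv j).trans (by norm_num))]
    exact (abs_sub _ _).trans (by linarith [hv i, hv j])

theorem mean_signEnvironment {k : ℕ} (v : Fin k → ℝ) (hv : ∀ i, |v i| ≤ 1 / 2) (i : Fin k) :
    (signEnvironment v hv).mean i = v i :=
  integral_signLaw ((hv i).trans (by norm_num))

/-- The second moment of the density of the symmetric sign law with respect to the law of mean `d`
is `1 / (1 - d ^ 2)`. -/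
theorem sq_lintegral_signLaw_zero_le {d : ℝ} (hd : |d| ≤ 1 / 2) {f : ℝ → ℝ≥0∞}
    (hf : Measurable f) :
    (∫⁻ x, f x ∂(signLaw 0)) ^ 2 ≤
      ENNReal.ofReal (1 / (1 - d ^ 2)) * ∫⁻ x, f x ^ 2 ∂(signLaw d) := by
  obtain ⟨h1, h2⟩ := abs_le.1 hd
  have hK : 0 < 1 - d ^ 2 := by nlinarith
  rw [lintegral_signLaw _ hf, lintegral_signLaw _ (hf.pow_const 2)]
  have hp : 0 < (1 + d) / 2 := by linarith
  have hq : 0 < (1 - d) / 2 := by linarith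
  generalize f 1 = x
  generalize f (-1) = y
  have hK' : ENNReal.ofReal (1 / (1 - d ^ 2)) ≠ 0 := by simpa using hK
  by_cases hx : x = ∞
  · rw [hx, ENNReal.top_pow two_ne_zero, ENNReal.mul_top (ENNReal.ofReal_pos.2 hp).ne', top_add,
      ENNReal.mul_top hK']
    exact le_top
  by_cases hy : y = ∞
  · rw [hy, ENNReal.top_pow two_ne_zero, ENNReal.mul_top (ENNReal.ofReal_pos.2 hq).ne', add_top,
      ENNReal.mul_top hK']
    exact le_top
  lift x to NNReal using hx
  lift y to NNReal using hy
  rw [← ENNReal.ofReal_coe_nnreal, ← ENNReal.ofReal_coe_nnreal, ← ENNReal.ofReal_pow (by positivity),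
    ← ENNReal.ofReal_pow (by positivity), ← ENNReal.ofReal_mul (by positivity),
    ← ENNReal.ofReal_mul (by positivity), ← ENNReal.ofReal_mul (by positivity),
    ← ENNReal.ofReal_mul (by positivity), ← ENNReal.ofReal_add (by positivity) (by positivity),
    ← ENNReal.ofReal_add (by positivity) (by positivity), ← ENNReal.ofReal_pow (by positivity),
    ← ENNReal.ofReal_mul (by positivity)]
  refine ENNReal.ofReal_le_ofReal ?_
  rw [one_div, inv_mul_eq_div, le_div_iff₀ hK]
  nlinarith [sq_nonneg ((1 + d) / 2 * (x : ℝ) - (1 - d) / 2 * y)]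

theorem abs_update_zero_le {k : ℕ} (i : Fin k) {d : ℝ} (hd : |d| ≤ 1 / 2) (j : Fin k) :
    |Function.update (0 : Fin k → ℝ) i d j| ≤ 1 / 2 := by
  by_cases h : j = i
  · subst h; simpa using hd
  · simp [h]

/-- The environment in which action `i` has mean `d` and all other actions have mean `0`. -/
noncomputable def perturbedEnvironment {k : ℕ} (i : Fin k) (d : ℝ) (hd : |d| ≤ 1 / 2) : Environment k :=
  signEnvironment (Function.update 0 i d) (abs_update_zero_le i hd)

theorem mean_perturbedEnvironment {k : ℕ} (i : Fin k) (d : ℝ) (hd : |d| ≤ 1 / 2) (j : Fin k) :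
    (perturbedEnvironment i d hd).mean j = if j = i then d else 0 := by
  rw [perturbedEnvironment, mean_signEnvironment, Function.update_apply]; rfl

/-- The environment in which all actions are alike. -/
noncomputable def neutralEnvironment (k : ℕ) : Environment k :=
  signEnvironment 0 (fun _ ↦ by norm_num)

section

variable {k : ℕ} [NeZero k]

/-- An event on the actions that has probability `ρ` in the neutral environment, and on which
action `i` is played at most `s` times before the event is decided, still has probability at least
`ρ² / 3` if the mean of action `i` is moved by `d` with `2 d² s ≤ 1`. -/
theorem measureReal_perturbed_ge (π : Policy k) (T : ℕ) (i : Fin k) (d : ℝ) (hd : |d| ≤ 1 / 2)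
    (A : ℕ → (ℕ → Fin k) → Prop)
    (hA : ∀ t a a', (∀ s < t, a s = a' s) → A t a → A t a')
    (E : (ℕ → Fin k) → Prop)
    (hdet : ∀ j ≤ T, ∀ a a', (∀ t < j, a t = a' t) → ¬ A j a → E a → E a')
    (s : ℕ) (hs : 2 * d ^ 2 * s ≤ 1)
    (hcount : open scoped Classical in
      ∀ a, E a → ((Finset.range T).filter fun t ↦ A t a ∧ a t = i).card ≤ s) :
    ((historyMeasure π (neutralEnvironment k) T).real {h | E (actions h)}) ^ 2 / 3 ≤
      (historyMeasure π (perturbedEnvironment i d hd) T).real {h | E (actions h)} := by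
  classical
  set P₀ := historyMeasure π (neutralEnvironment k) T
  set P₁ := historyMeasure π (perturbedEnvironment i d hd) T
  set K := 1 / (1 - d ^ 2) with hK
  have hd2 : d ^ 2 ≤ 1 / 4 := by
    rw [← sq_abs]; nlinarith [abs_nonneg d]
  have hK1 : 1 ≤ K := by
    rw [hK, le_div_iff₀ (by linarith)]; nlinarith
  have hKs : K ^ s ≤ 3 := by
    have h1 : K ≤ Real.exp (2 * d ^ 2) := by
      refine le_trans ?_ (Real.add_one_le_exp _)
      rw [hK, div_le_iff₀ (by linarith)]
      nlinarith [sq_nonneg d]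
    calc K ^ s ≤ Real.exp (2 * d ^ 2) ^ s := by gcongr
      _ = Real.exp (2 * d ^ 2 * s) := by rw [← Real.exp_nat_mul]; ring_nf
      _ ≤ Real.exp 1 := by gcongr
      _ ≤ 3 := Real.exp_one_lt_d9.le.trans (by norm_num)
  have hE : MeasurableSet {h : History k T | E (actions h)} := measurableSet_setOf_actions E
  set w : Fin k → ℝ≥0∞ := fun a ↦ if a = i then ENNReal.ofReal K else 1 with hw
  have hwle : ∀ a, ∀ g : ℝ → ℝ≥0∞, Measurable g →
      (∫⁻ x, g x ∂((neutralEnvironment k).law a)) ^ 2 ≤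
        w a * ∫⁻ x, g x ^ 2 ∂((perturbedEnvironment i d hd).law a) := by
    intro a g hg
    by_cases ha : a = i
    · subst ha
      simpa [hw, hK, neutralEnvironment, perturbedEnvironment, signEnvironment] using
        sq_lintegral_signLaw_zero_le hd hg
    · have h0 : IsProbabilityMeasure (signLaw 0) := isProbabilityMeasure_signLaw (by simp)
      simpa [hw, neutralEnvironment, perturbedEnvironment, signEnvironment, ha] using
        sq_lintegral_le (signLaw 0) hg
  have hmain := sq_lintegral_le_changeWeight π (neutralEnvironment k) (perturbedEnvironment i d hd)
    w hwle A hA T ({h : History k T | E (actions h)}.indicator 1)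
    (measurable_one.indicator hE) (fun j hj h h' hhh' hAj ↦ by
      have h1 : ∀ t < j, actions h t = actions h' t := fun t ht ↦ by
        simp only [actions, hhh' t ht]
      have h2 : E (actions h) ↔ E (actions h') :=
        ⟨hdet j hj _ _ h1 hAj, hdet j hj _ _ (fun t ht ↦ (h1 t ht).symm)
          fun h3 ↦ hAj (hA j _ _ (fun t ht ↦ (h1 t ht).symm) h3)⟩
      simp only [Set.indicator, Set.mem_ofPred_eq, h2, Pi.one_apply])
  rw [lintegral_indicator_one hE] at hmain
  have hbound : ∀ h : History k T, ({h : History k T | E (actions h)}.indicator 1 h : ℝ≥0∞) ^ 2 *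
      changeWeight A w T (actions h) ≤
        ENNReal.ofReal (K ^ s) * {h : History k T | E (actions h)}.indicator 1 h := by
    intro h
    by_cases hEh : E (actions h)
    · simp only [Set.indicator, Set.mem_ofPred_eq, hEh, if_true, Pi.one_apply, one_pow, one_mul,
        mul_one]
      have h1 : changeWeight A w T (actions h) = ENNReal.ofReal K ^
          ((Finset.range T).filter fun t ↦ A t (actions h) ∧ actions h t = i).card := by
        rw [← Finset.prod_const, Finset.prod_filter]
        refine Finset.prod_congr rfl fun t _ ↦ ?_
        by_cases h1 : A t (actions h) <;> by_cases h2 : actions h t = i <;> simp [h1, h2, hw]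
      rw [h1, ENNReal.ofReal_pow (by linarith)]
      exact pow_le_pow_right₀ (by simpa using hK1) (hcount _ hEh)
    · simp [Set.indicator, hEh]
  have h2 : P₀ {h | E (actions h)} ^ 2 ≤ ENNReal.ofReal (K ^ s) * P₁ {h | E (actions h)} := by
    refine hmain.trans ((lintegral_mono hbound).trans ?_)
    rw [lintegral_const_mul _ (measurable_one.indicator hE), lintegral_indicator_one hE]
  have h3 := ENNReal.toReal_mono (ENNReal.mul_ne_top ENNReal.ofReal_ne_top (measure_ne_top _ _)) h2
  rw [ENNReal.toReal_pow, ENNReal.toReal_mul, ENNReal.toReal_ofReal (by positivity)] at h3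
  have h4 : 0 ≤ P₁.real {h | E (actions h)} := measureReal_nonneg
  have h5 : P₀.real {h | E (actions h)} ^ 2 ≤ K ^ s * P₁.real {h | E (actions h)} := h3
  nlinarith

/-- If, on an event, the regret accumulated along the history is at least `G`, then the regret is at
least `G` times the probability of the event. -/
theorem mul_measureReal_le_regretIn (π : Policy k) (D : Environment k) (T : ℕ) (G : ℝ)
    (E : (ℕ → Fin k) → Prop)
    (hG : ∀ᵐ h ∂(historyMeasure π D T), E (actions h) →
      G ≤ ∑ t ∈ Finset.range T, ((⨆ i, D.mean i) - D.mean (actions h t))) :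
    G * (historyMeasure π D T).real {h | E (actions h)} ≤ regretIn π D T := by
  have hE : MeasurableSet {h : History k T | E (actions h)} := measurableSet_setOf_actions E
  rw [regretIn_eq_integral]
  calc G * (historyMeasure π D T).real {h | E (actions h)}
      = ∫ h, {h : History k T | E (actions h)}.indicator (fun _ ↦ G) h
          ∂(historyMeasure π D T) := by
        rw [integral_indicator_const _ hE, smul_eq_mul, mul_comm]
    _ ≤ _ := by
      refine integral_mono_ae ((integrable_const G).indicator hE)
        (Integrable.of_mem_Icc 0 (T : ℝ) (measurable_sum_gap D T).aemeasurable (.of_forall fun h ↦ ⟨sum_gap_nonneg D _ T, sum_gap_le D _ T⟩)) ?_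
      filter_upwards [hG] with h hh
      by_cases hEh : E (actions h)
      · simpa [Set.indicator, hEh] using hh hEh
      · simpa [Set.indicator, hEh] using sum_gap_nonneg D (actions h) T

/-- Among finitely many events on the actions that together exhaust all possibilities,
one has probability at least one over their number. -/
theorem exists_one_div_card_le_measureReal {ι : Type*} [Fintype ι] (π : Policy k)
    (D : Environment k) (T : ℕ) (E : ι → (ℕ → Fin k) → Prop)
    (hE : ∀ a, ∃ i, E i a) :
    ∃ i, 1 / (Fintype.card ι : ℝ) ≤ (historyMeasure π D T).real {h | E i (actions h)} := by
  have hne : Nonempty ι := ⟨(hE fun _ ↦ 0).choose⟩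
  by_contra! hcon
  have h1 : (1 : ℝ) ≤ ∑ i, (historyMeasure π D T).real {h | E i (actions h)} := by
    refine le_trans (le_of_eq ?_) (measureReal_iUnion_fintype_le (μ := historyMeasure π D T)
      (fun i ↦ {h | E i (actions h)}))
    rw [← probReal_univ (μ := historyMeasure π D T)]
    congr 1
    symm
    exact Set.eq_univ_of_forall fun h ↦ Set.mem_iUnion.2 (hE (actions h))
  have h2 : ∑ i, (historyMeasure π D T).real {h | E i (actions h)} <
      ∑ _i : ι, 1 / (Fintype.card ι : ℝ) :=
    Finset.sum_lt_sum_of_nonempty Finset.univ_nonempty fun i _ ↦ hcon i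
  have hc : (Fintype.card ι : ℝ) ≠ 0 := by exact_mod_cast Fintype.card_ne_zero
  rw [Finset.sum_const, Finset.card_univ, nsmul_eq_mul, mul_one_div_cancel hc] at h2
  linarith

end

/-! ### Switches and covers of a sequence of actions -/

/-- The number of switches `a t ≠ a (t + 1)` with `t < n`. -/
def numSwitches {k : ℕ} (a : ℕ → Fin k) (n : ℕ) : ℕ :=
  ((Finset.range n).filter fun t ↦ a t ≠ a (t + 1)).card

theorem numSwitches_succ {k : ℕ} (a : ℕ → Fin k) (n : ℕ) :
    numSwitches a (n + 1) = numSwitches a n + if a n = a (n + 1) then 0 else 1 := by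
  unfold numSwitches
  rw [Finset.range_add_one, Finset.filter_insert]
  by_cases h : a n = a (n + 1) <;> simp [h]

theorem numSwitches_mono {k : ℕ} (a : ℕ → Fin k) : Monotone (numSwitches a) :=
  monotone_nat_of_le_succ fun n ↦ by rw [numSwitches_succ]; omega

theorem totalSwitchingCost_unitCost {k T : ℕ} [NeZero k] (h : History k T) :
    totalSwitchingCost (unitCost k) (fun t ↦ (h t).1) = numSwitches (actions h) (T - 1) := by
  unfold totalSwitchingCost numSwitches unitCost
  rw [Finset.card_filter, Nat.cast_sum,
    ← Fin.sum_univ_eq_sum_range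
      (fun t ↦ ((if actions h t ≠ actions h (t + 1) then 1 else 0 : ℕ) : ℝ≥0∞))]
  refine Finset.sum_congr rfl fun t _ ↦ ?_
  have h1 : (t : ℕ) < T := by omega
  have h2 : (t : ℕ) + 1 < T := by omega
  by_cases h3 : (h ⟨t, h1⟩).1 = (h ⟨t + 1, h2⟩).1 <;> simp [actions, extend, h1, h2, h3]

/-- One step of the covering process. The state is the number of completed covers together with the
set of actions played since the last cover was completed; the action completing a cover also
starts the next one. -/
def coverStep {k : ℕ} (s : ℕ × Finset (Fin k)) (i : Fin k) : ℕ × Finset (Fin k) :=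
  if insert i s.2 = Finset.univ then (s.1 + 1, {i}) else (s.1, insert i s.2)

/-- The state of the covering process after the first `n` actions. -/
def cover {k : ℕ} (a : ℕ → Fin k) : ℕ → ℕ × Finset (Fin k)
  | 0 => (0, ∅)
  | n + 1 => coverStep (cover a n) (a n)

section

variable {k : ℕ} (a : ℕ → Fin k)

theorem cover_congr {a a' : ℕ → Fin k} {n : ℕ} (h : ∀ t < n, a t = a' t) :
    cover a n = cover a' n := by
  induction n with
  | zero => rfl
  | succ n ih =>
    rw [cover, cover, ih fun t ht ↦ h t (by omega), h n (by omega)]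

theorem cover_succ_fst (n : ℕ) : (cover a (n + 1)).1 =
    (cover a n).1 + if insert (a n) (cover a n).2 = Finset.univ then 1 else 0 := by
  rw [cover, coverStep]; split <;> rfl

theorem cover_succ_snd (n : ℕ) : (cover a (n + 1)).2 =
    if insert (a n) (cover a n).2 = Finset.univ then {a n} else insert (a n) (cover a n).2 := by
  rw [cover, coverStep]; split <;> rfl

theorem cover_fst_mono : Monotone fun n ↦ (cover a n).1 :=
  monotone_nat_of_le_succ fun n ↦ by rw [cover_succ_fst]; omega

/-- With at least two actions, completing a cover never leaves the next one complete as well. -/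
theorem cover_snd_ne_univ (hk : 2 ≤ k) (n : ℕ) : (cover a n).2 ≠ Finset.univ := by
  have hne : ∀ s : Finset (Fin k), s.card ≤ 1 → s ≠ Finset.univ := fun s hs h ↦ by
    rw [h, Finset.card_univ, Fintype.card_fin] at hs; omega
  cases n with
  | zero => exact hne _ (by simp [cover])
  | succ n =>
    rw [cover_succ_snd]
    split
    · exact hne _ (by simp)
    · assumption

/-- Every cover costs `k - 1` switches. -/
theorem cover_le_numSwitches (hk : 2 ≤ k) (n : ℕ) : a n ∈ (cover a (n + 1)).2 ∧
    (cover a (n + 1)).1 * (k - 1) + (cover a (n + 1)).2.card ≤ numSwitches a n + 1 := by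
  induction n with
  | zero =>
    have h : insert (a 0) (∅ : Finset (Fin k)) ≠ Finset.univ := fun h ↦ by
      have := congrArg Finset.card h
      simp at this
      omega
    rw [cover_succ_fst, cover_succ_snd]
    simp only [cover, h, if_false]
    simp
  | succ n ih =>
    obtain ⟨h1, h2⟩ := ih
    rw [cover_succ_fst a (n + 1), cover_succ_snd a (n + 1), numSwitches_succ]
    have h3 : (insert (a (n + 1)) (cover a (n + 1)).2).card ≤
        (cover a (n + 1)).2.card + if a n = a (n + 1) then 0 else 1 := by
      split
      · next h => rw [← h, Finset.insert_eq_of_mem h1]; simp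
      · exact Finset.card_insert_le _ _
    split
    · next h =>
      rw [h, Finset.card_univ, Fintype.card_fin] at h3
      refine ⟨by simp, ?_⟩
      rw [add_mul, Finset.card_singleton]
      omega
    · refine ⟨by simp, ?_⟩
      rw [add_zero]
      omega

theorem mem_cover_snd_of_fst_eq {u v : ℕ} (h : (cover a u).1 = (cover a v).1) {t : ℕ}
    (hu : u ≤ t) (hv : t < v) : a t ∈ (cover a v).2 := by
  induction v, hv using Nat.le_induction with
  | base =>
    rw [cover_succ_snd]; split <;> simp
  | succ v hv ih =>
    have h1 : (cover a u).1 ≤ (cover a v).1 := cover_fst_mono a (by omega)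
    have h2 := cover_succ_fst a v
    have h3 : insert (a v) (cover a v).2 ≠ Finset.univ := fun h3 ↦ by
      rw [if_pos h3] at h2; omega
    rw [if_neg h3] at h2
    rw [cover_succ_snd, if_neg h3]
    exact Finset.mem_insert_of_mem (ih (by omega))

theorem exists_forall_ne_of_cover_fst_eq (hk : 2 ≤ k) {u v : ℕ}
    (h : (cover a u).1 = (cover a v).1) : ∃ i, ∀ t, u ≤ t → t < v → a t ≠ i := by
  obtain ⟨i, hi⟩ : ∃ i, i ∉ (cover a v).2 := by
    by_contra! hcon
    exact cover_snd_ne_univ a hk v (Finset.eq_univ_of_forall hcon)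
  exact ⟨i, fun t hu hv hti ↦ hi (hti ▸ mem_cover_snd_of_fst_eq a h hu hv)⟩

/-- Given a time grid, either some action is absent from one of the first `m + 1` cells, or there
are at least `m` covers at the end of the first `m` cells and one more in the next cell. -/
theorem exists_absent_or_le_cover (hk : 2 ≤ k) {τ : ℕ → ℕ} (hτ : Monotone τ) (m : ℕ) :
    (∃ j ≤ m, ∃ i, ∀ t, τ j ≤ t → t < τ (j + 1) → a t ≠ i) ∨
      (m ≤ (cover a (τ m)).1 ∧ m + 1 ≤ (cover a (τ (m + 1))).1) := by
  by_cases h : ∃ j ≤ m, (cover a (τ j)).1 = (cover a (τ (j + 1))).1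
  · obtain ⟨j, hj, h⟩ := h
    exact Or.inl ⟨j, hj, exists_forall_ne_of_cover_fst_eq a hk h⟩
  · push Not at h
    have h1 : ∀ j ≤ m + 1, j ≤ (cover a (τ j)).1 := by
      intro j
      induction j with
      | zero => simp
      | succ j ih =>
        intro hj
        have h2 := ih (by omega)
        have h3 : (cover a (τ j)).1 ≤ (cover a (τ (j + 1))).1 := cover_fst_mono a (hτ (by omega))
        have h4 := h j (by omega)
        omega
    exact Or.inr ⟨h1 m (by omega), h1 (m + 1) le_rfl⟩

/-- Cover number `m + 1` is completed by playing `x` in a round `t < v`, while cover number `m` was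
completed within the first `u` rounds. -/
def CoversWith (m u v : ℕ) (x : Fin k) (a : ℕ → Fin k) : Prop :=
  m ≤ (cover a u).1 ∧ ∃ t < v, (cover a t).1 = m ∧ (cover a (t + 1)).1 = m + 1 ∧ a t = x

theorem exists_coversWith {m u v : ℕ} (hu : m ≤ (cover a u).1) (hv : m + 1 ≤ (cover a v).1) :
    ∃ x, CoversWith m u v x a := by
  have hex : ∃ n, m + 1 ≤ (cover a n).1 := ⟨v, hv⟩
  classical
  obtain ⟨t, ht⟩ : ∃ t, Nat.find hex = t + 1 := Nat.exists_eq_succ_of_ne_zero fun h0 ↦ by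
    have := Nat.find_spec hex
    rw [h0] at this
    simp [cover] at this
  have h1 := Nat.find_spec hex
  have h2 := Nat.find_min hex (m := t) (by omega)
  have h3 : Nat.find hex ≤ v := Nat.find_min' hex hv
  rw [ht] at h1
  have h4 := cover_succ_fst a t
  have h5 : (if insert (a t) (cover a t).2 = Finset.univ then 1 else 0) ≤ 1 := by split <;> simp
  exact ⟨a t, hu, t, by omega, by omega, by omega, rfl⟩

variable {a}

/-- The action that completes a cover was not played since that cover was started, hence has been
sampled few times. -/
theorem CoversWith.card_le {m u v : ℕ} {x : Fin k} (hk : 2 ≤ k) (h : CoversWith m u v x a) (T : ℕ) :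
    ((Finset.range T).filter fun t ↦ (cover a t).1 ≤ m ∧ a t = x).card ≤ u + 1 := by
  obtain ⟨hu, t₀, -, h1, h2, h3⟩ := h
  have hsub : ((Finset.range T).filter fun t ↦ (cover a t).1 ≤ m ∧ a t = x) ⊆
      insert t₀ (Finset.range u) := by
    intro t ht
    simp only [Finset.mem_filter, Finset.mem_insert, Finset.mem_range] at ht ⊢
    by_contra! hcon
    obtain ⟨hne, hut⟩ := hcon
    rcases lt_or_gt_of_ne hne with hlt | hgt
    · have h4 : (cover a u).1 = (cover a t₀).1 :=
        le_antisymm (cover_fst_mono a (by omega)) (by omega)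
      have h5 := mem_cover_snd_of_fst_eq a h4 hut hlt
      rw [ht.2.2, ← h3] at h5
      have h6 := cover_succ_fst a t₀
      rw [Finset.insert_eq_of_mem h5, if_neg (cover_snd_ne_univ a hk t₀)] at h6
      omega
    · have : (cover a (t₀ + 1)).1 ≤ (cover a t).1 := cover_fst_mono a hgt
      omega
  calc _ ≤ (insert t₀ (Finset.range u)).card := Finset.card_le_card hsub
    _ ≤ u + 1 := (Finset.card_insert_le _ _).trans (by simp)

/-- When the budget is used up by `m + 1` covers, the last action is played forever. -/
theorem CoversWith.eq_of_numSwitches_le {m u v : ℕ} {x : Fin k} (hk : 2 ≤ k)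
    (h : CoversWith m u v x a) {T : ℕ} (hT : numSwitches a (T - 1) ≤ (m + 1) * (k - 1)) {t : ℕ}
    (hvt : v ≤ t) (htT : t < T) : a t = x := by
  obtain ⟨-, t₀, hv, -, h2, h3⟩ := h
  have h4 := (cover_le_numSwitches a hk t₀).2
  have h4' := (cover_le_numSwitches a hk t₀).1
  have h5 : 0 < (cover a (t₀ + 1)).2.card := Finset.card_pos.2 ⟨_, h4'⟩
  rw [h2] at h4
  have ht : t₀ ≤ t := by omega
  clear hvt hv
  induction t, ht using Nat.le_induction with
  | base => exact h3
  | succ t ht ih =>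
    have h6 := ih (by omega)
    have h7 : numSwitches a t₀ ≤ numSwitches a t := numSwitches_mono a ht
    have h8 : numSwitches a (t + 1) ≤ numSwitches a (T - 1) := numSwitches_mono a (by omega)
    rw [numSwitches_succ] at h8
    by_contra hne
    rw [h6, if_neg (Ne.symm hne)] at h8
    omega

/-- The event is decided as soon as cover number `m + 1` is completed. -/
theorem CoversWith.congr {m u v : ℕ} {x : Fin k} {a' : ℕ → Fin k} (h : CoversWith m u v x a)
    {j : ℕ} (hj : m < (cover a j).1) (haa' : ∀ t < j, a t = a' t) : CoversWith m u v x a' := by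
  obtain ⟨hu, t, hv, h1, h2, h3⟩ := h
  have htj : t < j := by
    by_contra! hcon
    have : (cover a j).1 ≤ (cover a t).1 := cover_fst_mono a hcon
    omega
  refine ⟨?_, t, hv, ?_, ?_, ?_⟩
  · rcases le_or_gt u j with huj | huj
    · rwa [← cover_congr fun s hs ↦ haa' s (by omega)]
    · have h4 : (cover a' j).1 ≤ (cover a' u).1 := cover_fst_mono a' huj.le
      rw [← cover_congr haa'] at h4
      omega
  · rwa [← cover_congr fun s hs ↦ haa' s (by omega)]
  · rwa [← cover_congr fun s hs ↦ haa' s (by omega)]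
  · rw [← haa' t htj, h3]

end

/-! ### Lower bounds from a single event -/

theorem card_mul_le_sum_gap {k : ℕ} (D : Environment k) (a : ℕ → Fin k) (T : ℕ) (d : ℝ)
    (s : Finset ℕ) (hs : s ⊆ Finset.range T) (h : ∀ t ∈ s, d ≤ (⨆ i, D.mean i) - D.mean (a t)) :
    s.card * d ≤ ∑ t ∈ Finset.range T, ((⨆ i, D.mean i) - D.mean (a t)) := by
  calc s.card * d = ∑ _t ∈ s, d := by simp
    _ ≤ ∑ t ∈ s, ((⨆ i, D.mean i) - D.mean (a t)) := Finset.sum_le_sum h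
    _ ≤ _ := Finset.sum_le_sum_of_subset_of_nonneg hs fun t _ _ ↦
      sub_nonneg.2 (mean_le_iSup D _)

section

variable {k : ℕ} [NeZero k]

theorem regretIn_le_regret (π : Policy k) (D : Environment k) (T : ℕ) :
    regretIn π D T ≤ regret π T :=
  le_ciSup (f := fun D ↦ regretIn π D T) ⟨T, by
    rintro _ ⟨D, rfl⟩; exact (regretIn_mem_Icc (NeZero.ne k) π D T).2⟩ D

theorem abs_one_div_two_mul_sqrt_le {s : ℝ} (hs : 1 ≤ s) : |1 / (2 * √s)| ≤ 1 / 2 := by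
  have h1 : 1 ≤ √s := Real.one_le_sqrt.2 hs
  rw [abs_of_nonneg (by positivity)]
  gcongr
  linarith

theorem two_mul_sq_one_div_two_mul_sqrt {s : ℝ} (hs : 1 ≤ s) :
    2 * (1 / (2 * √s)) ^ 2 * s ≤ 1 := by
  rw [div_pow, mul_pow, Real.sq_sqrt (by linarith)]
  have : s ≠ 0 := by linarith
  field_simp
  norm_num

/-- An action not played in the rounds `u ≤ t < v` has been sampled at most `u` times by round `v`,
so it might be better than the others by `1 / √u`. -/
theorem regret_ge_of_absent (π : Policy k) {u v T : ℕ} (huv : u ≤ v) (hvT : v ≤ T) (i : Fin k) :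
    (v - u) * (1 / (2 * √(max (u : ℝ) 1))) *
      (((historyMeasure π (neutralEnvironment k) T).real
        {h | ∀ t, u ≤ t → t < v → actions h t ≠ i}) ^ 2 / 3) ≤ regret π T := by
  set d := 1 / (2 * √(max (u : ℝ) 1)) with hd
  have hd1 : |d| ≤ 1 / 2 := abs_one_div_two_mul_sqrt_le (le_max_right _ _)
  have hd0 : 0 ≤ d := by positivity
  have h1 := measureReal_perturbed_ge π T i d hd1 (fun t _ ↦ t < v) (fun _ _ _ _ h ↦ h)
    (fun a ↦ ∀ t, u ≤ t → t < v → a t ≠ i)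
    (fun j _ a a' haa' hj h t hut htv ↦ by rw [← haa' t (by omega)]; exact h t hut htv) u
    (le_trans (by gcongr; exact le_max_left _ _) (two_mul_sq_one_div_two_mul_sqrt
      (le_max_right (u : ℝ) 1)))
    (fun a ha ↦ by
      calc _ ≤ (Finset.range u).card := Finset.card_le_card fun t ht ↦ by
            simp only [Finset.mem_filter, Finset.mem_range] at ht ⊢
            by_contra! hcon
            exact ha t hcon ht.2.1 ht.2.2
        _ = u := Finset.card_range u)
  refine le_trans ?_ (regretIn_le_regret π (perturbedEnvironment i d hd1) T)
  refine le_trans (mul_le_mul_of_nonneg_left h1 (mul_nonneg ?_ hd0))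
    (mul_measureReal_le_regretIn π _ T _ (fun a ↦ ∀ t, u ≤ t → t < v → a t ≠ i)
      (.of_forall fun h hh ↦ ?_))
  · exact sub_nonneg.2 (by exact_mod_cast huv)
  · have h2 := card_mul_le_sum_gap (perturbedEnvironment i d hd1) (actions h) T d
      (Finset.Ico u v) (fun t ht ↦ by
        rw [Finset.mem_Ico] at ht; rw [Finset.mem_range]; omega) (fun t ht ↦ by
        rw [Finset.mem_Ico] at ht
        have h3 := mean_le_iSup (perturbedEnvironment i d hd1) i
        rw [mean_perturbedEnvironment, if_pos rfl] at h3
        rw [mean_perturbedEnvironment _ _ _ (actions h t), if_neg (hh t ht.1 ht.2)]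
        linarith)
    rwa [Nat.card_Ico, Nat.cast_sub huv] at h2

/-- An action that completes the last affordable cover is played forever, although it has been
sampled at most `u + 1` times, so that it might be worse than the others by `1 / √(u + 1)`. -/
theorem regret_ge_of_coversWith (hk : 2 ≤ k) (π : Policy k) {S m u v T : ℕ}
    (hπ : IsBudgetPolicy (unitCost k) S T π) (hS : S ≤ (m + 1) * (k - 1)) (hvT : v ≤ T)
    (x : Fin k) :
    (T - v) * (1 / (2 * √(u + 1))) *
      (((historyMeasure π (neutralEnvironment k) T).real
        {h | CoversWith m u v x (actions h)}) ^ 2 / 3) ≤ regret π T := by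
  set d := 1 / (2 * √((u : ℝ) + 1)) with hd
  have hu1 : (1 : ℝ) ≤ u + 1 := by linarith [Nat.cast_nonneg (α := ℝ) u]
  have hd1 : |-d| ≤ 1 / 2 := by
    rw [abs_neg]; exact abs_one_div_two_mul_sqrt_le hu1
  have hd0 : 0 ≤ d := by positivity
  have h1 := measureReal_perturbed_ge π T x (-d) hd1 (fun t a ↦ (cover a t).1 ≤ m)
    (fun t a a' haa' h ↦ by rwa [← cover_congr haa'])
    (CoversWith m u v x) (fun j _ a a' haa' hj h ↦ h.congr (by omega) haa') (u + 1)
    (by rw [neg_sq]; push_cast; exact two_mul_sq_one_div_two_mul_sqrt hu1)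
    (fun a ha ↦ le_trans (Finset.card_le_card fun t ht ↦ by
      simpa only [Finset.mem_filter] using ht) (ha.card_le hk T))
  refine le_trans ?_ (regretIn_le_regret π (perturbedEnvironment x (-d) hd1) T)
  refine le_trans (mul_le_mul_of_nonneg_left h1 (mul_nonneg ?_ hd0))
    (mul_measureReal_le_regretIn π _ T _ _ ?_)
  · exact sub_nonneg.2 (by exact_mod_cast hvT)
  · filter_upwards [hπ (perturbedEnvironment x (-d) hd1)] with h hcost hh
    rw [totalSwitchingCost_unitCost] at hcost
    have hcost' : numSwitches (actions h) (T - 1) ≤ (m + 1) * (k - 1) :=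
      le_trans (by exact_mod_cast hcost) hS
    have h2 := card_mul_le_sum_gap (perturbedEnvironment x (-d) hd1) (actions h) T d
      (Finset.Ico v T) (fun t ht ↦ by
        rw [Finset.mem_Ico] at ht; rw [Finset.mem_range]; omega) (fun t ht ↦ by
        rw [Finset.mem_Ico] at ht
        obtain ⟨y, hy⟩ : ∃ y : Fin k, y ≠ x := by
          have : Nontrivial (Fin k) := Fin.nontrivial_iff_two_le.2 hk
          exact exists_ne x
        have h3 := mean_le_iSup (perturbedEnvironment x (-d) hd1) y
        rw [mean_perturbedEnvironment, if_neg hy] at h3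
        rw [mean_perturbedEnvironment _ _ _ (actions h t),
          if_pos (hh.eq_of_numSwitches_le hk hcost' ht.1 ht.2)]
        linarith)
    rwa [Nat.card_Ico, Nat.cast_sub hvT] at h2

/-- Without any restriction on switching, the regret is of order at least `√T`. -/
theorem sqrt_le_regret (hk : 2 ≤ k) (π : Policy k) {T : ℕ} (hT : 1 ≤ T) :
    √T / (12 * k ^ 2) ≤ regret π T := by
  classical
  have hT1 : (1 : ℝ) ≤ T := by exact_mod_cast hT
  obtain ⟨i, hi⟩ := exists_one_div_card_le_measureReal π (neutralEnvironment k) T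
    (fun (i : Fin k) a ↦ 2 * ((Finset.range T).filter fun t ↦ a t = i).card ≤ T) (fun a ↦ by
      by_contra! hcon
      have h1 := Finset.card_eq_sum_card_fiberwise (s := Finset.range T) (t := Finset.univ) (f := a)
        (fun _ _ ↦ Finset.mem_coe.2 (Finset.mem_univ _))
      rw [Finset.card_range] at h1
      have h2 : ∑ i : Fin k, T < ∑ i : Fin k, 2 * ((Finset.range T).filter fun t ↦ a t = i).card :=
        Finset.sum_lt_sum_of_nonempty Finset.univ_nonempty fun i _ ↦ hcon i
      rw [← Finset.mul_sum, ← h1, Finset.sum_const, Finset.card_univ, Fintype.card_fin,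
        smul_eq_mul] at h2
      nlinarith)
  rw [Fintype.card_fin] at hi
  set d := 1 / (2 * √(T : ℝ)) with hd
  have hd1 : |d| ≤ 1 / 2 := abs_one_div_two_mul_sqrt_le hT1
  have hd0 : 0 ≤ d := by positivity
  have h1 := measureReal_perturbed_ge π T i d hd1 (fun t _ ↦ t < T) (fun _ _ _ _ h ↦ h)
    (fun a ↦ 2 * ((Finset.range T).filter fun t ↦ a t = i).card ≤ T)
    (fun j hj a a' haa' hjT h ↦ by
      have : ∀ t < T, a t = a' t := fun t ht ↦ haa' t (by omega)
      rwa [Finset.filter_congr fun t ht ↦ by rw [← this t (Finset.mem_range.1 ht)]]) T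
    (two_mul_sq_one_div_two_mul_sqrt hT1)
    (fun a _ ↦ by
      refine (Finset.card_le_card fun t ht ↦ ?_).trans (Finset.card_range T).le
      simp only [Finset.mem_filter] at ht
      exact ht.1)
  refine le_trans ?_ (regretIn_le_regret π (perturbedEnvironment i d hd1) T)
  refine le_trans ?_ (mul_measureReal_le_regretIn π _ T (T / 2 * d)
    (fun a ↦ 2 * ((Finset.range T).filter fun t ↦ a t = i).card ≤ T) (.of_forall fun h hh ↦ ?_))
  · refine le_trans ?_ (mul_le_mul_of_nonneg_left h1 (by positivity))
    have hk0 : (0 : ℝ) < k := by exact_mod_cast (by omega : 0 < k)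
    calc √T / (12 * k ^ 2) = T / 2 * d * ((1 / (k : ℝ)) ^ 2 / 3) := by
          rw [hd]
          have h2 : √(T : ℝ) ≠ 0 := by positivity
          have h3 : (T : ℝ) = √(T : ℝ) * √T := (Real.mul_self_sqrt (by linarith)).symm
          rw [eq_comm]
          nth_rewrite 1 [h3]
          field_simp
          norm_num
      _ ≤ _ := by gcongr
  · have h2 := card_mul_le_sum_gap (perturbedEnvironment i d hd1) (actions h) T d
      ((Finset.range T).filter fun t ↦ ¬ actions h t = i) (Finset.filter_subset _ _)
      (fun t ht ↦ by
        have h3 := mean_le_iSup (perturbedEnvironment i d hd1) i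
        rw [mean_perturbedEnvironment, if_pos rfl] at h3
        rw [mean_perturbedEnvironment _ _ _ (actions h t), if_neg (Finset.mem_filter.1 ht).2]
        linarith)
    refine le_trans ?_ h2
    gcongr
    have h4 := Finset.card_filter_add_card_filter_not (s := Finset.range T)
      (fun t ↦ actions h t = i)
    rw [Finset.card_range] at h4
    have h5 : T ≤ 2 * ((Finset.range T).filter fun t ↦ ¬ actions h t = i).card := by omega
    have h6 : (T : ℝ) ≤ 2 * ((Finset.range T).filter fun t ↦ ¬ actions h t = i).card := by
      exact_mod_cast h5
    linarith

end

/-! ### The lower bound -/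

section

variable {k : ℕ} [NeZero k]

/-- On a time grid with cells of length at least `r √t` that ends before `T / 2`, each of the
`(m + 2) * k` possible events (an action absent from a cell, or completing the last cover) forces a
regret of order `r` times the square of its probability. -/
theorem regret_ge_of_grid (hk : 2 ≤ k) (π : Policy k) {S m T : ℕ}
    (hπ : IsBudgetPolicy (unitCost k) S T π) (hS : S ≤ (m + 1) * (k - 1)) {r : ℝ} (hr : 0 ≤ r)
    {τ : ℕ → ℕ} (hτ : Monotone τ) (hτT : 2 * τ (m + 1) ≤ T)
    (hgrid : ∀ j, r * √(max (τ j : ℝ) 1) ≤ τ (j + 1) - τ j) :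
    r / (12 * ((m + 2) * k) ^ 2) ≤ regret π T := by
  have hk0 : (0 : ℝ) < k := by exact_mod_cast (by omega : 0 < k)
  obtain ⟨⟨j, i⟩, hj⟩ := exists_one_div_card_le_measureReal π (neutralEnvironment k) T
    (fun (p : Option (Fin (m + 1)) × Fin k) a ↦ match p with
      | (some j, i) => ∀ t, τ j ≤ t → t < τ (j + 1) → a t ≠ i
      | (none, i) => CoversWith m (τ m) (τ (m + 1)) i a) (fun a ↦ by
      rcases exists_absent_or_le_cover a hk hτ m with ⟨j, hj, i, hi⟩ | ⟨h1, h2⟩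
      · exact ⟨(some ⟨j, by omega⟩, i), hi⟩
      · obtain ⟨x, hx⟩ := exists_coversWith a h1 h2
        exact ⟨(none, x), hx⟩)
  have hcard : (Fintype.card (Option (Fin (m + 1)) × Fin k) : ℝ) = (m + 2) * k := by
    rw [Fintype.card_prod, Fintype.card_option, Fintype.card_fin, Fintype.card_fin]
    push_cast
    ring
  rw [hcard] at hj
  have hρ : r / (12 * ((m + 2) * k) ^ 2) = r / 4 * ((1 / ((m + 2) * k)) ^ 2 / 3) := by
    field_simp
    ring
  rw [hρ]
  match j, hj with
  | some j, hj =>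
    have hjm : τ (j + 1) ≤ T := (hτ (by omega : (j : ℕ) + 1 ≤ m + 1)).trans (by omega)
    refine le_trans ?_ (regret_ge_of_absent π (hτ (Nat.le_succ _)) hjm i)
    have h1 := hgrid j
    have h2 : 0 < √(max (τ j : ℝ) 1) := Real.sqrt_pos.2 (lt_max_of_lt_right one_pos)
    have h3 : r / 4 ≤ (τ (j + 1) - τ j) * (1 / (2 * √(max (τ j : ℝ) 1))) := by
      rw [mul_one_div, le_div_iff₀ (by positivity)]
      nlinarith [mul_nonneg hr h2.le]
    gcongr
    exact le_trans (by positivity) h3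
  | none, hj =>
    refine le_trans ?_ (regret_ge_of_coversWith hk π (u := τ m) hπ hS (by omega : τ (m + 1) ≤ T) i)
    have h1 := hgrid m
    have h2 : 0 < √((τ m : ℝ) + 1) := Real.sqrt_pos.2 (by positivity)
    have h4 : √((τ m : ℝ) + 1) ≤ 2 * √(max (τ m : ℝ) 1) := by
      have h5 : (2 : ℝ) * √(max (τ m : ℝ) 1) = √(2 ^ 2 * max (τ m : ℝ) 1) := by
        rw [Real.sqrt_mul (by positivity), Real.sqrt_sq (by norm_num)]
      rw [h5]
      refine Real.sqrt_le_sqrt ?_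
      linarith [le_max_left (τ m : ℝ) 1, le_max_right (τ m : ℝ) 1]
    have h6 : (2 : ℝ) * τ (m + 1) ≤ T := by exact_mod_cast hτT
    have h3 : r / 4 ≤ (T - τ (m + 1)) * (1 / (2 * √((τ m : ℝ) + 1))) := by
      rw [mul_one_div, le_div_iff₀ (by positivity)]
      nlinarith [mul_le_mul_of_nonneg_left h4 hr, Nat.cast_nonneg (α := ℝ) (τ m)]
    gcongr
    exact le_trans (by positivity) h3

end

/-- The inverse `2 - 2 ^ (-m)` of the regret exponent. It satisfies `e 0 = 1` and
`e (m + 1) = 1 + e m / 2`, which mirrors the passage from a period of length `n` to one of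
length `r √n`. -/
noncomputable def gridExponent (m : ℕ) : ℝ := 2 - (2 : ℝ) ^ (-(m : ℝ))

theorem gridExponent_zero : gridExponent 0 = 1 := by norm_num [gridExponent]

theorem gridExponent_succ (m : ℕ) : gridExponent (m + 1) = 1 + gridExponent m / 2 := by
  unfold gridExponent
  rw [Nat.cast_succ, neg_add, Real.rpow_add (by norm_num), Real.rpow_neg_one]
  ring

theorem one_le_gridExponent (m : ℕ) : 1 ≤ gridExponent m := by
  have : (2 : ℝ) ^ (-(m : ℝ)) ≤ 1 := Real.rpow_le_one_of_one_le_of_nonpos (by norm_num) (by simp)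
  unfold gridExponent
  linarith

theorem gridExponent_le_two (m : ℕ) : gridExponent m ≤ 2 := by
  have : 0 < (2 : ℝ) ^ (-(m : ℝ)) := by positivity
  unfold gridExponent
  linarith

theorem rpow_gridExponent_succ {r : ℝ} (hr : 0 < r) (m : ℕ) :
    r ^ gridExponent (m + 1) = r * √(r ^ gridExponent m) := by
  rw [gridExponent_succ, Real.rpow_add hr, Real.rpow_one, Real.sqrt_eq_rpow, ← Real.rpow_mul hr.le]
  ring_nf

/-- The time grid of the lower bound: the cell that starts at time `t` has length about `r √t`. -/
noncomputable def grid (r : ℝ) : ℕ → ℕ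
  | 0 => 0
  | j + 1 => grid r j + ⌈r * √(max (grid r j : ℝ) 1)⌉₊

theorem grid_mono (r : ℝ) : Monotone (grid r) :=
  monotone_nat_of_le_succ fun j ↦ by rw [grid]; omega

/-- The cells grow at the rate `R ^ (2 - 2 ^ (-j))` of the exponent recursion. The quadratic factor
absorbs the start `t` of the cell in `t + r √t`. -/
theorem grid_succ_le {r : ℝ} (hr : 1 ≤ r) (j : ℕ) :
    (grid r (j + 1) : ℝ) ≤ (j + 2) ^ 2 * r ^ gridExponent j := by
  have hceil : ∀ j, (grid r (j + 1) : ℝ) ≤ grid r j + 2 * (r * √(max (grid r j : ℝ) 1)) := by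
    intro j
    have h1 : 1 ≤ √(max (grid r j : ℝ) 1) := Real.one_le_sqrt.2 (le_max_right _ _)
    have h2 : 1 ≤ r * √(max (grid r j : ℝ) 1) := one_le_mul_of_one_le_of_one_le hr h1
    have h3 := Nat.ceil_lt_add_one (by linarith : 0 ≤ r * √(max (grid r j : ℝ) 1))
    rw [grid]
    push_cast
    linarith
  induction j with
  | zero =>
    have := hceil 0
    simp only [grid, gridExponent_zero] at this ⊢
    simp at this ⊢
    linarith
  | succ j ih =>
    refine (hceil (j + 1)).trans ?_
    have h1 : (1 : ℝ) ≤ grid r (j + 1) := by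
      have h2 : 1 ≤ grid r 1 := by
        rw [grid]
        simp [grid]
        linarith
      exact_mod_cast h2.trans (grid_mono r (by omega))
    rw [max_eq_left h1, rpow_gridExponent_succ (by linarith)]
    set x := r ^ gridExponent j
    have hx1 : 1 ≤ x := Real.one_le_rpow hr (by linarith [one_le_gridExponent j])
    have hxr : √x ≤ r := by
      rw [Real.sqrt_le_left (by linarith), ← Real.rpow_two]
      exact Real.rpow_le_rpow_of_exponent_le hr (gridExponent_le_two j)
    have hxx : x ≤ r * √x := by
      calc x = √x * √x := (Real.mul_self_sqrt (by linarith)).symm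
        _ ≤ r * √x := by gcongr
    have h3 : √(grid r (j + 1) : ℝ) ≤ (j + 2) * √x := by
      calc √(grid r (j + 1) : ℝ) ≤ √((j + 2) ^ 2 * x) := Real.sqrt_le_sqrt ih
        _ = (j + 2) * √x := by rw [Real.sqrt_mul (by positivity), Real.sqrt_sq (by positivity)]
    have h4 : r * √(grid r (j + 1) : ℝ) ≤ (j + 2) * (r * √x) := by
      calc r * √(grid r (j + 1) : ℝ) ≤ r * ((j + 2) * √x) := by gcongr
        _ = _ := by ring
    have h5 : ((j : ℝ) + 2) ^ 2 * x ≤ (j + 2) ^ 2 * (r * √x) := by gcongr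
    have h6 : 0 ≤ r * √x := by positivity
    push_cast
    nlinarith

/-- The lower bound with a loss that is polynomial in the number of covers. -/
theorem rpow_div_le_regret {k : ℕ} (hk : 2 ≤ k) (π : Policy k) {S m T : ℕ}
    (hπ : IsBudgetPolicy (unitCost k) S T π) (hS : S ≤ (m + 1) * (k - 1)) (hT : 1 ≤ T) :
    (T : ℝ) ^ (1 / gridExponent m) / (24 * k ^ 2 * (m + 2) ^ 4) ≤ regret π T := by
  have : NeZero k := ⟨by omega⟩
  have hk0 : (0 : ℝ) < k := by exact_mod_cast (by omega : 0 < k)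
  have hT1 : (1 : ℝ) ≤ T := by exact_mod_cast hT
  have he := one_le_gridExponent m
  set R := (T : ℝ) ^ (1 / gridExponent m) with hR
  have hRpos : 0 < R := by positivity
  -- The factor makes the grid end before `T / 2`.
  set r := R / (2 * (m + 2) ^ 2) with hr
  have hRr : R / (24 * k ^ 2 * (m + 2) ^ 4) = r / (12 * ((m + 2) * k) ^ 2) := by
    rw [hr]; field_simp; norm_num
  rw [hRr]
  rcases le_or_gt 1 r with h1 | h1
  · refine regret_ge_of_grid hk π hπ hS (by linarith) (grid_mono r) ?_ fun j ↦ ?_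
    · have h2 := grid_succ_le h1 m
      have h3 : r ^ gridExponent m ≤ T / (2 * (m + 2) ^ 2) := by
        have h4 : (1 : ℝ) ≤ 2 * (m + 2) ^ 2 := by nlinarith [Nat.cast_nonneg (α := ℝ) m]
        rw [hr, Real.div_rpow hRpos.le (by positivity), hR, ← Real.rpow_mul (by linarith),
          one_div_mul_cancel (by linarith), Real.rpow_one]
        gcongr
        calc (2 * ((m : ℝ) + 2) ^ 2) = (2 * ((m : ℝ) + 2) ^ 2) ^ (1 : ℝ) := (Real.rpow_one _).symm
          _ ≤ _ := Real.rpow_le_rpow_of_exponent_le h4 he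
      have h5 : (grid r (m + 1) : ℝ) ≤ T / 2 := by
        calc _ ≤ ((m : ℝ) + 2) ^ 2 * (T / (2 * (m + 2) ^ 2)) := h2.trans (by gcongr)
          _ = T / 2 := by field_simp
      have h6 : (2 * grid r (m + 1) : ℝ) ≤ T := by linarith
      exact_mod_cast h6
    · have h2 := Nat.le_ceil (r * √(max (grid r j : ℝ) 1))
      rw [grid]
      push_cast
      linarith
  · refine le_trans ?_ (sqrt_le_regret hk π hT)
    have h2 : 1 ≤ √(T : ℝ) := Real.one_le_sqrt.2 hT1
    have h3 : (k : ℝ) ^ 2 ≤ ((m + 2) * k) ^ 2 := by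
      have : (1 : ℝ) ≤ m + 2 := by linarith [Nat.cast_nonneg (α := ℝ) m]
      gcongr
      exact le_mul_of_one_le_left hk0.le this
    gcongr
    linarith

/-! ### Concentration along adaptively collected data -/

theorem lintegral_exp_sub_mean_le {k : ℕ} (D : Environment k) (i : Fin k) (c : ℝ) :
    ∫⁻ x, ENNReal.ofReal (Real.exp (c * (x - D.mean i))) ∂(D.law i) ≤
      ENNReal.ofReal (Real.exp (c ^ 2 / 2)) := by
  have h : HasSubgaussianMGF (fun x ↦ x - D.mean i) 1 (D.law i) := D.subgaussian i
  rw [← ofReal_integral_eq_lintegral_ofReal (h.integrable_exp_mul c)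
    (.of_forall fun _ ↦ (Real.exp_pos _).le)]
  refine ENNReal.ofReal_le_ofReal ?_
  have := h.mgf_le c
  rw [NNReal.coe_one, one_mul] at this
  exact this

section

variable {k : ℕ} [NeZero k]

/-- The deviation of the reward of round `t` from the mean of the action played. -/
noncomputable def noise {n : ℕ} (D : Environment k) (h : History k n) (t : ℕ) : ℝ :=
  (extend h t).2 - D.mean (actions h t)

theorem measurable_noise {n : ℕ} (D : Environment k) (t : ℕ) :
    Measurable fun h : History k n ↦ noise D h t := by
  have h1 : Measurable fun h : History k n ↦ extend h t :=
    (measurable_pi_apply t).comp (measurable_extend n)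
  exact (measurable_snd.comp h1).sub ((measurable_of_countable D.mean).comp (measurable_fst.comp h1))

/-- Whatever the policy, weighted sums of the noise are sub-Gaussian. -/
theorem lintegral_exp_sum_noise_le (π : Policy k) (D : Environment k) (c : ℕ → ℝ) (n : ℕ) :
    ∫⁻ h, ENNReal.ofReal (Real.exp (∑ t ∈ Finset.range n, c t * noise D h t))
        ∂(historyMeasure π D n) ≤
      ENNReal.ofReal (Real.exp (∑ t ∈ Finset.range n, c t ^ 2 / 2)) := by
  induction n with
  | zero => simp
  | succ n ih =>
    have hm : ∀ n, Measurable fun h : History k n ↦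
        ENNReal.ofReal (Real.exp (∑ t ∈ Finset.range n, c t * noise D h t)) := fun n ↦
      ENNReal.measurable_ofReal.comp (Real.measurable_exp.comp
        (Finset.measurable_sum _ fun t _ ↦ (measurable_noise D t).const_mul _))
    rw [lintegral_historyMeasure_succ π D (hm (n + 1))]
    have hstep : ∀ h : History k n,
        ∫⁻ z, ENNReal.ofReal (Real.exp (∑ t ∈ Finset.range (n + 1),
          c t * noise D (Fin.snoc h z : History k (n + 1)) t)) ∂(stepKernel π D n h) ≤
        ENNReal.ofReal (Real.exp (∑ t ∈ Finset.range n, c t * noise D h t)) *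
          ENNReal.ofReal (Real.exp (c n ^ 2 / 2)) := by
      intro h
      have h1 : ∀ z : Fin k × ℝ, ENNReal.ofReal (Real.exp (∑ t ∈ Finset.range (n + 1),
          c t * noise D (Fin.snoc h z : History k (n + 1)) t)) =
          ENNReal.ofReal (Real.exp (∑ t ∈ Finset.range n, c t * noise D h t)) *
            ENNReal.ofReal (Real.exp (c n * (z.2 - D.mean z.1))) := fun z ↦ by
        rw [← ENNReal.ofReal_mul (Real.exp_pos _).le, ← Real.exp_add, Finset.sum_range_succ]
        congr 3
        · refine Finset.sum_congr rfl fun t ht ↦ ?_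
          rw [noise, noise, actions, actions, extend_snoc_of_lt _ _ (Finset.mem_range.1 ht)]
        · rw [noise, actions, extend_snoc_self]
      have hm2 : Measurable fun z : Fin k × ℝ ↦
          ENNReal.ofReal (Real.exp (c n * (z.2 - D.mean z.1))) :=
        ENNReal.measurable_ofReal.comp (Real.measurable_exp.comp
          ((measurable_snd.sub ((measurable_of_countable D.mean).comp measurable_fst)).const_mul _))
      simp only [h1]
      rw [lintegral_const_mul _ hm2, lintegral_stepKernel π D h hm2]
      gcongr
      calc _ ≤ ∫⁻ _a, ENNReal.ofReal (Real.exp (c n ^ 2 / 2)) ∂(π.kernel n h) :=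
            lintegral_mono fun a ↦ lintegral_exp_sub_mean_le D a (c n)
        _ = _ := by simp
    refine (lintegral_mono hstep).trans ?_
    rw [lintegral_mul_const _ (hm n), Finset.sum_range_succ, Real.exp_add,
      ENNReal.ofReal_mul (Real.exp_pos _).le]
    gcongr

/-- One-sided tail bound, for `σ = ±1`. -/
theorem measureReal_le_sum_noise_le (π : Policy k) (D : Environment k) {T N : ℕ} (s : Finset ℕ)
    (hs : s ⊆ Finset.range T) (hN : s.card = N) (hN0 : 0 < N) {L : ℝ} (hL : 0 ≤ L)
    {σ : ℝ} (hσ : σ ^ 2 = 1) :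
    (historyMeasure π D T).real {h | √(2 * N * L) ≤ ∑ t ∈ s, σ * noise D h t} ≤ Real.exp (-L) := by
  have hNpos : (0 : ℝ) < N := by exact_mod_cast hN0
  set ε := √(2 * N * L) with hε
  have hε2 : ε ^ 2 = 2 * N * L := Real.sq_sqrt (by positivity)
  -- `ε / N` is the optimal tilt in the Chernoff bound for a sum of `N` sub-Gaussian terms.
  set c : ℕ → ℝ := fun t ↦ if t ∈ s then ε / N * σ else 0 with hc
  have h1 := lintegral_exp_sum_noise_le π D c T
  have h2 : ∑ t ∈ Finset.range T, c t ^ 2 / 2 = L := by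
    have : ∀ t, c t ^ 2 / 2 = if t ∈ s then L / N else 0 := fun t ↦ by
      simp only [hc]
      split
      · rw [mul_pow, hσ, div_pow, hε2]; field_simp
      · simp
    simp only [this]
    rw [Finset.sum_ite_mem, Finset.inter_eq_right.2 hs, Finset.sum_const, hN, nsmul_eq_mul]
    field_simp
  have h3 : ∀ h : History k T, ∑ t ∈ Finset.range T, c t * noise D h t =
      ε / N * ∑ t ∈ s, σ * noise D h t := fun h ↦ by
    simp only [hc, ite_mul, zero_mul]
    rw [Finset.sum_ite_mem, Finset.inter_eq_right.2 hs, Finset.mul_sum]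
    exact Finset.sum_congr rfl fun t _ ↦ by ring
  rw [h2] at h1
  have hsub : {h : History k T | ε ≤ ∑ t ∈ s, σ * noise D h t} ⊆
      {h | ENNReal.ofReal (Real.exp (2 * L)) ≤
        ENNReal.ofReal (Real.exp (∑ t ∈ Finset.range T, c t * noise D h t))} := by
    intro h hh
    refine ENNReal.ofReal_le_ofReal (Real.exp_le_exp.2 ?_)
    rw [h3]
    have h4 : ε / N * ε ≤ ε / N * ∑ t ∈ s, σ * noise D h t :=
      mul_le_mul_of_nonneg_left hh (by positivity)
    have h5 : ε / N * ε = 2 * L := by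
      rw [div_mul_eq_mul_div, ← sq, hε2]; field_simp
    linarith
  have h4 := meas_ge_le_lintegral_div (μ := historyMeasure π D T)
    (f := fun h ↦ ENNReal.ofReal (Real.exp (∑ t ∈ Finset.range T, c t * noise D h t)))
    (ENNReal.measurable_ofReal.comp (Real.measurable_exp.comp
        (Finset.measurable_sum _ fun t _ ↦ (measurable_noise D t).const_mul _))).aemeasurable
    (ε := ENNReal.ofReal (Real.exp (2 * L))) (by simp [Real.exp_pos]) ENNReal.ofReal_ne_top
  have h5 : historyMeasure π D T {h | ε ≤ ∑ t ∈ s, σ * noise D h t} ≤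
      ENNReal.ofReal (Real.exp (-L)) := by
    refine (measure_mono hsub).trans (h4.trans ?_)
    refine (ENNReal.div_le_div_right h1 _).trans (le_of_eq ?_)
    rw [← ENNReal.ofReal_div_of_pos (Real.exp_pos _), ← Real.exp_sub]
    congr 2
    ring
  exact ENNReal.toReal_le_of_le_ofReal (Real.exp_pos _).le h5

theorem measureReal_lt_abs_sum_noise_le (π : Policy k) (D : Environment k) {T N : ℕ} (s : Finset ℕ)
    (hs : s ⊆ Finset.range T) (hN : s.card = N) (hN0 : 0 < N) {L : ℝ} (hL : 0 ≤ L) :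
    (historyMeasure π D T).real {h | √(2 * N * L) < |∑ t ∈ s, noise D h t|} ≤
      2 * Real.exp (-L) := by
  have h1 := measureReal_le_sum_noise_le π D s hs hN hN0 hL (σ := 1) (by norm_num)
  have h2 := measureReal_le_sum_noise_le π D s hs hN hN0 hL (σ := -1) (by norm_num)
  have hsub : {h : History k T | √(2 * N * L) < |∑ t ∈ s, noise D h t|} ⊆
      {h | √(2 * N * L) ≤ ∑ t ∈ s, 1 * noise D h t} ∪
        {h | √(2 * N * L) ≤ ∑ t ∈ s, -1 * noise D h t} := fun h hh ↦ by
    simp only [Set.mem_ofPred_eq, Set.mem_union, one_mul, neg_one_mul,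
      Finset.sum_neg_distrib] at hh ⊢
    rcases lt_abs.1 hh with h3 | h3
    · exact Or.inl h3.le
    · exact Or.inr h3.le
  refine (measureReal_mono hsub).trans ((measureReal_union_le _ _).trans ?_)
  linarith

/-! ### Deterministic policies -/

/-- The policy that plays `act t ω` in round `t`, where `ω` is the past read as a sequence. -/
noncomputable def deterministicPolicy (act : ℕ → (ℕ → Fin k × ℝ) → Fin k)
    (hact : ∀ t, Measurable (act t)) : Policy k where
  kernel t := Kernel.deterministic (fun h ↦ act t (extend h))
    ((hact t).comp (measurable_extend t))
  isMarkovKernel_kernel _ := inferInstance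

theorem ae_actions_deterministicPolicy (act : ℕ → (ℕ → Fin k × ℝ) → Fin k)
    (hact : ∀ t, Measurable (act t))
    (hadapt : ∀ t ω ω', (∀ s < t, ω s = ω' s) → act t ω = act t ω') (D : Environment k) (T : ℕ) :
    ∀ᵐ h ∂(historyMeasure (deterministicPolicy act hact) D T),
      ∀ t < T, actions h t = act t (extend h) := by
  have hms : ∀ n, MeasurableSet {h : History k n | ∀ t < n, actions h t = act t (extend h)} := by
    intro n
    simp only [Set.ofPred_forall]
    refine .iInter fun t ↦ .iInter fun _ ↦ measurableSet_eq_fun ?_ ?_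
    · exact measurable_fst.comp ((measurable_pi_apply t).comp (measurable_extend n))
    · exact (hact t).comp (measurable_extend n)
  induction T with
  | zero => simp
  | succ n ih =>
    rw [historyMeasure, ae_map_iff (measurable_snoc k n).aemeasurable (hms _)]
    refine Measure.ae_compProd_of_ae_ae ((measurable_snoc k n) (hms (n + 1))) ?_
    filter_upwards [ih] with h hh
    have h1 : ∀ᵐ z ∂(stepKernel (deterministicPolicy act hact) D n h),
        z.1 = act n (extend h) := by
      have hmz : MeasurableSet {z : Fin k × ℝ | z.1 ≠ act n (extend h)} :=
        (measurable_fst (measurableSet_singleton (act n (extend h)))).compl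
      rw [ae_iff, ← lintegral_indicator_one hmz, lintegral_stepKernel _ _ _
        (measurable_one.indicator hmz)]
      have hmf : Measurable fun a : Fin k ↦ ∫⁻ x, Set.indicator
          {z : Fin k × ℝ | z.1 ≠ act n (extend h)} (1 : Fin k × ℝ → ℝ≥0∞) (a, x) ∂(D.law a) :=
        measurable_of_countable _
      simp only [deterministicPolicy]
      rw [Kernel.deterministic_apply, lintegral_dirac' _ hmf]
      simp [Set.indicator]
    filter_upwards [h1] with z hz t ht
    have h2 : act t (extend (Fin.snoc h z : History k (n + 1))) = act t (extend h) :=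
      hadapt t _ _ fun s hs ↦ extend_snoc_of_lt h z (by omega)
    rw [h2]
    rcases Nat.lt_succ_iff_lt_or_eq.1 ht with h3 | h3
    · rw [← hh t h3, actions, extend_snoc_of_lt h z h3, actions]
    · rw [h3, actions, extend_snoc_self, hz]

end

/-! ### Blocks of rounds -/

/-- The first round of block `b`, when every epoch `l` consists of `k` blocks of length `n l`. -/
def blockStart (k : ℕ) (n : ℕ → ℕ) (b : ℕ) : ℕ := ∑ b' ∈ Finset.range b, n (b' / k)

/-- The block that contains round `t`. -/
def blockIndex (k : ℕ) (n : ℕ → ℕ) (t : ℕ) : ℕ := Nat.findGreatest (fun b ↦ blockStart k n b ≤ t) t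

/-- The sum of a sequence over block `b`. -/
def blockSum (k : ℕ) (n : ℕ → ℕ) (ρ : ℕ → ℝ) (b : ℕ) : ℝ :=
  ∑ t ∈ Finset.Ico (blockStart k n b) (blockStart k n (b + 1)), ρ t

section

variable {k : ℕ} {n : ℕ → ℕ}

theorem blockStart_succ (b : ℕ) : blockStart k n (b + 1) = blockStart k n b + n (b / k) :=
  Finset.sum_range_succ _ _

theorem blockStart_mono : Monotone (blockStart k n) :=
  monotone_nat_of_le_succ fun b ↦ by rw [blockStart_succ]; omega

theorem le_blockStart (hn : ∀ l, 1 ≤ n l) (b : ℕ) : b ≤ blockStart k n b := by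
  induction b with
  | zero => simp
  | succ b ih => rw [blockStart_succ]; have := hn (b / k); omega

theorem blockStart_blockIndex_le (t : ℕ) : blockStart k n (blockIndex k n t) ≤ t :=
  Nat.findGreatest_spec (P := fun b ↦ blockStart k n b ≤ t) (Nat.zero_le t)
    (by simp [blockStart])

theorem lt_blockStart_blockIndex_succ (hn : ∀ l, 1 ≤ n l) (t : ℕ) :
    t < blockStart k n (blockIndex k n t + 1) := by
  by_contra! hcon
  have h1 := (le_blockStart (k := k) hn (blockIndex k n t + 1)).trans hcon
  have h2 := Nat.le_findGreatest (P := fun b ↦ blockStart k n b ≤ t) h1 hcon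
  exact absurd h2 (by unfold blockIndex; omega)

theorem blockIndex_eq (hn : ∀ l, 1 ≤ n l) {b t : ℕ} (h1 : blockStart k n b ≤ t)
    (h2 : t < blockStart k n (b + 1)) : blockIndex k n t = b := by
  have h3 := blockStart_blockIndex_le (k := k) (n := n) t
  have h4 := lt_blockStart_blockIndex_succ (k := k) hn t
  by_contra hne
  rcases lt_or_gt_of_ne hne with h | h
  · have := blockStart_mono (k := k) (n := n) (show blockIndex k n t + 1 ≤ b by omega)
    omega
  · have := blockStart_mono (k := k) (n := n) (show b + 1 ≤ blockIndex k n t by omega)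
    omega

theorem blockIndex_succ (hn : ∀ l, 1 ≤ n l) (t : ℕ) :
    blockIndex k n (t + 1) = blockIndex k n t ∨ blockIndex k n (t + 1) = blockIndex k n t + 1 := by
  have h1 := blockStart_blockIndex_le (k := k) (n := n) t
  have h2 := lt_blockStart_blockIndex_succ (k := k) hn t
  rcases lt_or_ge (t + 1) (blockStart k n (blockIndex k n t + 1)) with h | h
  · exact Or.inl (blockIndex_eq hn (by omega) h)
  · refine Or.inr (blockIndex_eq hn h ?_)
    rw [blockStart_succ (blockIndex k n t + 1)]
    have := hn ((blockIndex k n t + 1) / k)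
    omega

theorem numSwitches_comp_blockIndex_le (hn : ∀ l, 1 ≤ n l) (X : ℕ → Fin k) (t : ℕ) :
    numSwitches (fun s ↦ X (blockIndex k n s)) t ≤ numSwitches X (blockIndex k n t) := by
  induction t with
  | zero => simp [numSwitches]
  | succ t ih =>
    rw [numSwitches_succ]
    rcases blockIndex_succ (k := k) hn t with h | h
    · simpa [h] using ih
    · rw [h, numSwitches_succ]
      omega

theorem blockStart_epoch_add (hk : 0 < k) (l j : ℕ) (hj : j ≤ k) :
    blockStart k n (l * k + j) = blockStart k n (l * k) + j * n l := by
  induction j with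
  | zero => simp
  | succ j ih =>
    rw [← add_assoc, blockStart_succ, ih (by omega), Nat.mul_comm l k, Nat.mul_add_div hk,
      Nat.div_eq_of_lt (by omega : j < k)]
    ring_nf

theorem numSwitches_add_le (X : ℕ → Fin k) (u j : ℕ) :
    numSwitches X (u + j) ≤ numSwitches X u + j := by
  induction j with
  | zero => simp
  | succ j ih =>
    rw [← add_assoc, numSwitches_succ]
    split <;> omega

/-- If in every epoch either its first two blocks or its first block and the preceding one use the
same action, then an epoch costs only `k - 1` switches. -/
theorem numSwitches_blocks_le (hk : 2 ≤ k) (X : ℕ → Fin k)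
    (hX : ∀ l, X ((l + 1) * k) = X ((l + 1) * k - 1) ∨ X ((l + 1) * k) = X ((l + 1) * k + 1))
    (l : ℕ) : numSwitches X (l * k) ≤ l * (k - 1) + 1 ∧
      numSwitches X (l * k + 1) ≤ l * (k - 1) + 1 := by
  induction l with
  | zero =>
    rw [zero_mul, zero_add, numSwitches_succ]
    have : numSwitches X 0 = 0 := by simp [numSwitches]
    rw [this]
    split <;> simp
  | succ l ih =>
    have h0 : (l + 1) * k = l * k + k := by ring
    have h0' : (l + 1) * (k - 1) = l * (k - 1) + (k - 1) := by ring
    have h1 := numSwitches_add_le X (l * k + 1) (k - 1)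
    have h2 := numSwitches_add_le X (l * k + 1) (k - 2)
    have e1 : l * k + 1 + (k - 1) = (l + 1) * k := by omega
    have e2 : l * k + 1 + (k - 2) = (l + 1) * k - 1 := by omega
    rw [e1] at h1
    rw [e2] at h2
    refine ⟨by omega, ?_⟩
    rw [numSwitches_succ]
    rcases hX l with h | h
    · have h3 := numSwitches_succ X ((l + 1) * k - 1)
      rw [Nat.sub_add_cancel (by omega), if_pos h.symm] at h3
      split <;> omega
    · rw [if_pos h]; omega

end

/-! ### Successive elimination with few switches -/

/-- Given the assignment `x` of actions to the slots of an epoch and the slots `G` whose action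
survives, the surviving actions can be assigned to the slots of the next epoch such that its first
slot continues with the last action played, or else agrees with the second slot. -/
theorem exists_next_schedule {k : ℕ} [NeZero k] (x : Fin k → Fin k) (G : Fin k → Prop) :
    ∃ y : Fin k → Fin k, (y 0 = x (Fin.ofNat k (k - 1)) ∨ y 0 = y 1) ∧
      ((∃ j, G j) → Set.range y = x '' {j | G j}) := by
  classical
  set a := x (Fin.ofNat k (k - 1)) with ha
  by_cases hG : ∃ j, G j
  swap
  · exact ⟨fun _ ↦ a, Or.inl rfl, fun h ↦ absurd h hG⟩
  set B := x '' {j | G j} with hB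
  have hBne : B.Nonempty := by
    obtain ⟨j, hj⟩ := hG
    exact ⟨x j, j, hj, rfl⟩
  -- The slots run through all actions, beginning with the last action `a` played; eliminated actions
  -- are replaced by a surviving one, `b`.
  set e := Equiv.swap (0 : Fin k) a with he
  have he0 : e 0 = a := Equiv.swap_apply_left _ _
  have hrange : ∀ b ∈ B, Set.range (fun j ↦ if e j ∈ B then e j else b) = B := by
    intro b hb
    ext i
    constructor
    · rintro ⟨j, rfl⟩
      simp only
      split
      · assumption
      · exact hb
    · intro hi
      exact ⟨e.symm i, by simp [hi]⟩
  by_cases haB : a ∈ B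
  · exact ⟨_, Or.inl (by simp [he0]), fun _ ↦ hrange a haB⟩
  by_cases h1 : e 1 ∈ B
  · exact ⟨_, Or.inr (by simp [he0, haB, h1]), fun _ ↦ hrange (e 1) h1⟩
  · obtain ⟨b, hb⟩ := hBne
    exact ⟨_, Or.inr (by simp [he0, haB, h1]), fun _ ↦ hrange b hb⟩

section

variable {k : ℕ} [NeZero k]

/-- An assignment of the surviving actions to the slots of the next epoch as in
`exists_next_schedule`. -/
noncomputable def nextSchedule (x : Fin k → Fin k) (G : Fin k → Prop) : Fin k → Fin k :=
  (exists_next_schedule x G).choose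

/-- Slot `j` of epoch `l` survives if the sum of the rewards in its block is within twice the
confidence radius `√(2 n L)` of the largest such sum in the epoch. -/
def Survives (n : ℕ → ℕ) (L : ℝ) (l : ℕ) (ρ : ℕ → ℝ) (j : Fin k) : Prop :=
  ∀ j' : Fin k, blockSum k n ρ (l * k + j') - 2 * √(2 * n l * L) ≤ blockSum k n ρ (l * k + j)

/-- The assignment of actions to the slots of epoch `l`, given the sequence `ρ` of rewards. -/
noncomputable def schedule (n : ℕ → ℕ) (L : ℝ) : ℕ → (ℕ → ℝ) → Fin k → Fin k
  | 0, _ => id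
  | l + 1, ρ => nextSchedule (schedule n L l ρ) (Survives n L l ρ)

/-- The action played in block `b`. -/
noncomputable def blockAction (n : ℕ → ℕ) (L : ℝ) (ρ : ℕ → ℝ) (b : ℕ) : Fin k :=
  schedule n L (b / k) ρ (Fin.ofNat k b)

theorem blockAction_epoch (n : ℕ → ℕ) (L : ℝ) (ρ : ℕ → ℝ) (l : ℕ) (j : Fin k) :
    blockAction n L ρ (l * k + j) = schedule n L l ρ j := by
  have hk : 0 < k := NeZero.pos k
  unfold blockAction
  rw [Nat.mul_comm l k, Nat.mul_add_div hk, Nat.div_eq_of_lt j.2, add_zero]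
  congr 1
  ext
  simp [Fin.ofNat, Nat.mod_eq_of_lt j.2]

/-- A new epoch begins with the action of the preceding block, or its first two blocks agree. -/
theorem blockAction_epoch_start (hk : 2 ≤ k) (n : ℕ → ℕ) (L : ℝ) (ρ : ℕ → ℝ) (l : ℕ) :
    blockAction (k := k) n L ρ ((l + 1) * k) = blockAction n L ρ ((l + 1) * k - 1) ∨
      blockAction (k := k) n L ρ ((l + 1) * k) = blockAction n L ρ ((l + 1) * k + 1) := by
  have h0 := blockAction_epoch n L ρ (l + 1) (0 : Fin k)
  have h1 := blockAction_epoch n L ρ (l + 1) (1 : Fin k)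
  have h2 := blockAction_epoch n L ρ l (Fin.ofNat k (k - 1))
  have e1 : ((1 : Fin k) : ℕ) = 1 := by
    have : ((1 : Fin k) : ℕ) = 1 % k := Fin.val_one' k
    rw [this, Nat.mod_eq_of_lt (by omega)]
  have e2 : ((Fin.ofNat k (k - 1) : Fin k) : ℕ) = k - 1 := Nat.mod_eq_of_lt (by omega)
  have e3 : l * k + (k - 1) = (l + 1) * k - 1 := by
    have : (l + 1) * k = l * k + k := by ring
    omega
  rw [Fin.val_zero, add_zero] at h0
  rw [e1] at h1
  rw [e2, e3] at h2
  rw [h0, h1, h2]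
  exact (exists_next_schedule (schedule n L l ρ) (Survives n L l ρ)).choose_spec.1

theorem range_schedule_succ {n : ℕ → ℕ} {L : ℝ} {l : ℕ} {ρ : ℕ → ℝ}
    (h : ∃ j : Fin k, Survives n L l ρ j) :
    Set.range (schedule (k := k) n L (l + 1) ρ) =
      schedule n L l ρ '' {j | Survives n L l ρ j} :=
  (exists_next_schedule (schedule n L l ρ) (Survives n L l ρ)).choose_spec.2 h

/-- The assignment for epoch `l` uses the rewards of the preceding epochs only. -/
theorem schedule_congr {n : ℕ → ℕ} {L : ℝ} {l : ℕ} {ρ ρ' : ℕ → ℝ}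
    (h : ∀ t < blockStart k n (l * k), ρ t = ρ' t) :
    schedule (k := k) n L l ρ = schedule n L l ρ' := by
  induction l with
  | zero => rfl
  | succ l ih =>
    have hle : blockStart k n (l * k) ≤ blockStart k n ((l + 1) * k) :=
      blockStart_mono (Nat.mul_le_mul_right _ (by omega))
    have h1 : ∀ j : Fin k, blockSum k n ρ (l * k + j) = blockSum k n ρ' (l * k + j) := fun j ↦ by
      refine Finset.sum_congr rfl fun t ht ↦ h t ?_
      rw [Finset.mem_Ico] at ht
      refine ht.2.trans_le (blockStart_mono ?_)
      rw [add_mul, one_mul]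
      have := j.2
      omega
    have h2 : (Survives n L l ρ : Fin k → Prop) = Survives n L l ρ' := by
      funext j
      simp only [Survives, h1]
    rw [schedule, schedule, ih fun t ht ↦ h t (by omega), h2]

theorem measurable_schedule (n : ℕ → ℕ) (L : ℝ) (l : ℕ) :
    Measurable (schedule (k := k) n L l) := by
  induction l with
  | zero => exact measurable_const
  | succ l ih =>
    have h1 : Measurable fun ρ : ℕ → ℝ ↦ (Survives n L l ρ : Fin k → Prop) := by
      refine measurable_pi_iff.2 fun j ↦ measurable_to_prop ?_
      have h2 : ∀ b, Measurable fun ρ : ℕ → ℝ ↦ blockSum k n ρ b := fun b ↦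
        Finset.measurable_sum _ fun t _ ↦ measurable_pi_apply t
      have h3 : (fun ρ : ℕ → ℝ ↦ Survives n L l ρ j) ⁻¹' {True} = ⋂ j' : Fin k,
          {ρ | blockSum k n ρ (l * k + j') - 2 * √(2 * n l * L) ≤ blockSum k n ρ (l * k + j)} := by
        ext ρ
        simp [Survives]
      rw [h3]
      exact .iInter fun j' ↦ measurableSet_le ((h2 _).sub_const _) (h2 _)
    have h2 : Measurable fun p : (Fin k → Fin k) × (Fin k → Prop) ↦ nextSchedule p.1 p.2 :=
      measurable_of_countable _
    exact h2.comp (ih.prodMk h1)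

/-- The successive elimination policy: in round `t` it plays the action of the current block. The
number of epochs is encoded in the block lengths: if `n m` is at least the horizon, then the first
slot of epoch `m` lasts until the end. -/
noncomputable def eliminationPolicy (k : ℕ) [NeZero k] (n : ℕ → ℕ) (L : ℝ) : Policy k :=
  deterministicPolicy (fun t ω ↦ blockAction n L (fun s ↦ (ω s).2) (blockIndex k n t)) fun t ↦ by
    have h1 : Measurable fun ω : ℕ → Fin k × ℝ ↦ fun s ↦ (ω s).2 :=
      measurable_pi_iff.2 fun s ↦ measurable_snd.comp (measurable_pi_apply s)
    exact (measurable_pi_apply _).comp ((measurable_schedule n L _).comp h1)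

theorem ae_actions_eliminationPolicy (n : ℕ → ℕ) (L : ℝ) (D : Environment k) (T : ℕ) :
    ∀ᵐ h ∂(historyMeasure (eliminationPolicy k n L) D T), ∀ t < T,
      actions h t = blockAction n L (fun s ↦ (extend h s).2) (blockIndex k n t) := by
  refine ae_actions_deterministicPolicy _ _ (fun t ω ω' hω ↦ ?_) D T
  have h1 : blockIndex k n t / k * k ≤ blockIndex k n t := Nat.div_mul_le_self _ _
  have h2 := (blockStart_mono (k := k) (n := n) h1).trans (blockStart_blockIndex_le t)
  simp only [blockAction]
  rw [schedule_congr fun s hs ↦ by rw [hω s (by omega)]]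

theorem isBudgetPolicy_eliminationPolicy (hk : 2 ≤ k) {n : ℕ → ℕ} (hn : ∀ l, 1 ≤ n l) (L : ℝ)
    {S m T : ℕ} (hT : T ≤ n m) (hS : m * (k - 1) + 1 ≤ S) :
    IsBudgetPolicy (unitCost k) S T (eliminationPolicy k n L) := by
  intro D
  filter_upwards [ae_actions_eliminationPolicy n L D T] with h hh
  rw [totalSwitchingCost_unitCost]
  set X : ℕ → Fin k := blockAction n L fun s ↦ (extend h s).2 with hX
  have h1 : numSwitches (actions h) (T - 1) =
      numSwitches (fun s ↦ X (blockIndex k n s)) (T - 1) := by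
    unfold numSwitches
    congr 1
    refine Finset.filter_congr fun t ht ↦ ?_
    rw [Finset.mem_range] at ht
    rw [hh t (by omega), hh (t + 1) (by omega)]
  have h2 := numSwitches_comp_blockIndex_le (k := k) hn X (T - 1)
  have h3 : blockIndex k n (T - 1) ≤ m * k := by
    by_contra! hcon
    have h4 := blockStart_mono (k := k) (n := n) hcon
    have h5 := blockStart_blockIndex_le (k := k) (n := n) (T - 1)
    rw [Nat.succ_eq_add_one, blockStart_succ, Nat.mul_div_cancel _ (by omega)] at h4
    have h6 := hn m
    have h7 := le_blockStart (k := k) hn (m * k)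
    have h8 : T - 1 = 0 := by omega
    have h9 := le_blockStart (k := k) hn (blockIndex k n (T - 1))
    omega
  have h4 := (numSwitches_blocks_le hk X (blockAction_epoch_start hk n L _) m).1
  have h5 := numSwitches_mono X h3
  exact_mod_cast (by omega : numSwitches (actions h) (T - 1) ≤ S)

end

/-! ### Regret of successive elimination -/

/-- The bound on the gaps of the actions that are still in play in epoch `l`. -/
noncomputable def gapBound (n : ℕ → ℕ) (L : ℝ) : ℕ → ℝ
  | 0 => 1
  | l + 1 => 4 * √(2 * n l * L) / n l

theorem gapBound_nonneg (n : ℕ → ℕ) (L : ℝ) (l : ℕ) : 0 ≤ gapBound n L l := by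
  cases l with
  | zero => exact zero_le_one
  | succ l => unfold gapBound; positivity

section

variable {k : ℕ} [NeZero k]

/-- If all block sums concentrate, a best action `i₀` survives and the surviving actions are nearly
as good. -/
theorem mem_range_schedule_and_gap_le {n : ℕ → ℕ} (hn : ∀ l, 1 ≤ n l) {L : ℝ} {m T : ℕ}
    {ρ : ℕ → ℝ} {μ : Fin k → ℝ} {i₀ : Fin k} (hi₀ : ∀ i, μ i ≤ μ i₀) (hgap : ∀ i, μ i₀ - μ i ≤ 1)
    (hgood : ∀ b < m * k, blockStart k n (b + 1) ≤ T →
      |blockSum k n ρ b - n (b / k) * μ (blockAction n L ρ b)| ≤ √(2 * n (b / k) * L))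
    (l : ℕ) (hl : l ≤ m) (hlT : blockStart k n (l * k) ≤ T) :
    i₀ ∈ Set.range (schedule n L l ρ) ∧
      ∀ j, μ i₀ - μ (schedule n L l ρ j) ≤ gapBound n L l := by
  have hk : 0 < k := NeZero.pos k
  induction l with
  | zero => exact ⟨⟨i₀, rfl⟩, fun j ↦ hgap _⟩
  | succ l ih =>
    have hlk : (l + 1) * k = l * k + k := by ring
    have hmk : (l + 1) * k ≤ m * k := Nat.mul_le_mul_right _ hl
    obtain ⟨⟨j₀, hj₀⟩, -⟩ := ih (by omega) ((blockStart_mono (by omega)).trans hlT)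
    have hest : ∀ j : Fin k, |blockSum k n ρ (l * k + j) - n l * μ (schedule n L l ρ j)| ≤
        √(2 * n l * L) := fun j ↦ by
      have hj := j.2
      have h1 := hgood (l * k + j) (by omega) ((blockStart_mono (by omega)).trans hlT)
      rwa [blockAction_epoch, Nat.mul_comm l k, Nat.mul_add_div hk, Nat.div_eq_of_lt hj, add_zero,
        Nat.mul_comm k l] at h1
    have hnl : (0 : ℝ) < n l := by exact_mod_cast hn l
    have hest₀ := abs_le.1 (hest j₀)
    rw [hj₀] at hest₀
    have hsurv : Survives n L l ρ j₀ := fun j' ↦ by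
      have h1 := abs_le.1 (hest j')
      have h2 : (n l : ℝ) * μ (schedule n L l ρ j') ≤ n l * μ i₀ := by gcongr; exact hi₀ _
      linarith [h1.2, hest₀.1]
    have hrange := range_schedule_succ ⟨j₀, hsurv⟩
    refine ⟨hrange ▸ ⟨j₀, hsurv, hj₀⟩, fun j ↦ ?_⟩
    obtain ⟨j₁, hj₁, hjj₁⟩ : schedule n L (l + 1) ρ j ∈
        schedule n L l ρ '' {j | Survives n L l ρ j} := hrange ▸ ⟨j, rfl⟩
    rw [← hjj₁, gapBound, le_div_iff₀ hnl]
    have h1 := abs_le.1 (hest j₁)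
    have h2 := hj₁ j₀
    linarith [h1.1, h1.2, hest₀.1, hest₀.2]

/-- Summing the gap bounds over the rounds: epoch `l < m` consists of `k * n l` rounds, and the rest
of the horizon is charged to epoch `m`. -/
theorem sum_gapBound_le {n : ℕ → ℕ} (hn : ∀ l, 1 ≤ n l) (L : ℝ) {m T : ℕ} (hT : T ≤ n m) :
    ∑ t ∈ Finset.range T, gapBound n L (blockIndex k n t / k) ≤
      ∑ l ∈ Finset.range m, (k * n l) * gapBound n L l + T * gapBound n L m := by
  have hk : 0 < k := NeZero.pos k
  have hmem : ∀ t ∈ Finset.range T, blockIndex k n t / k ∈ Finset.range (m + 1) := by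
    intro t ht
    rw [Finset.mem_range] at ht ⊢
    rw [Nat.div_lt_iff_lt_mul hk]
    by_contra! hcon
    have h1 := blockStart_mono (k := k) (n := n) hcon
    have h2 := blockStart_blockIndex_le (k := k) (n := n) t
    have h3 := blockStart_epoch_add (n := n) hk m k le_rfl
    rw [show m * k + k = (m + 1) * k by ring] at h3
    have h4 : n m ≤ k * n m := Nat.le_mul_of_pos_left _ hk
    omega
  rw [← Finset.sum_fiberwise_of_maps_to hmem, Finset.sum_range_succ]
  have hfib : ∀ l, ∑ t ∈ (Finset.range T).filter (fun t ↦ blockIndex k n t / k = l),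
      gapBound n L (blockIndex k n t / k) =
        ((Finset.range T).filter (fun t ↦ blockIndex k n t / k = l)).card * gapBound n L l :=
    fun l ↦ by
      rw [Finset.sum_congr rfl fun t ht ↦ by rw [(Finset.mem_filter.1 ht).2], Finset.sum_const,
        nsmul_eq_mul]
  simp only [hfib]
  refine add_le_add (Finset.sum_le_sum fun l _ ↦ ?_) ?_
  · refine mul_le_mul_of_nonneg_right ?_ (gapBound_nonneg n L l)
    have hsub : (Finset.range T).filter (fun t ↦ blockIndex k n t / k = l) ⊆
        Finset.Ico (blockStart k n (l * k)) (blockStart k n (l * k + k)) := by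
      intro t ht
      have hl := (Finset.mem_filter.1 ht).2
      rw [Finset.mem_Ico]
      have h1 : l * k ≤ blockIndex k n t := by rw [← hl]; exact Nat.div_mul_le_self _ _
      have h2 : blockIndex k n t + 1 ≤ l * k + k := by
        have := Nat.lt_div_mul_add (a := blockIndex k n t) hk
        rw [hl] at this
        omega
      exact ⟨(blockStart_mono h1).trans (blockStart_blockIndex_le t),
        (lt_blockStart_blockIndex_succ hn t).trans_le (blockStart_mono h2)⟩
    have hcard := Finset.card_le_card hsub
    rw [Nat.card_Ico, blockStart_epoch_add hk l k le_rfl, Nat.add_sub_cancel_left] at hcard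
    exact_mod_cast hcard
  · refine mul_le_mul_of_nonneg_right ?_ (gapBound_nonneg n L m)
    have := Finset.card_filter_le (Finset.range T) (fun t ↦ blockIndex k n t / k = m)
    rw [Finset.card_range] at this
    exact_mod_cast this

/-- The last term accounts for the failure of the confidence intervals of the `m * k` blocks. -/
theorem regretIn_eliminationPolicy_le {n : ℕ → ℕ} (hn : ∀ l, 1 ≤ n l) {L : ℝ} (hL : 0 ≤ L)
    {m T : ℕ} (hT : T ≤ n m) (D : Environment k) :
    regretIn (eliminationPolicy k n L) D T ≤
      ∑ l ∈ Finset.range m, (k * n l) * gapBound n L l + T * gapBound n L m +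
        T * (m * k * (2 * Real.exp (-L))) := by
  have hk : 0 < k := NeZero.pos k
  set P := historyMeasure (eliminationPolicy k n L) D T with hP
  set B := ∑ l ∈ Finset.range m, (k * n l) * gapBound n L l + T * gapBound n L m with hB
  set bad : ℕ → Set (History k T) := fun b ↦ {h | blockStart k n (b + 1) ≤ T ∧
    √(2 * n (b / k) * L) <
      |∑ t ∈ Finset.Ico (blockStart k n b) (blockStart k n (b + 1)), noise D h t|} with hbad
  set Bad : Set (History k T) := ⋃ b ∈ Finset.range (m * k), bad b with hBad
  have hbadm : ∀ b, MeasurableSet (bad b) := fun b ↦ by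
    have h1 : Measurable fun h : History k T ↦
        ∑ t ∈ Finset.Ico (blockStart k n b) (blockStart k n (b + 1)), noise D h t :=
      Finset.measurable_sum _ fun t _ ↦ measurable_noise D t
    simp only [hbad, Set.ofPred_and]
    exact (MeasurableSet.const _).inter
      (measurableSet_lt measurable_const (continuous_abs.measurable.comp h1))
  have hBadm : MeasurableSet Bad := Finset.measurableSet_biUnion _ fun b _ ↦ hbadm b
  have hBadP : P.real Bad ≤ m * k * (2 * Real.exp (-L)) := by
    refine (measureReal_biUnion_finset_le _ _).trans ?_
    have h1 : ∀ b, P.real (bad b) ≤ 2 * Real.exp (-L) := fun b ↦ by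
      by_cases hb : blockStart k n (b + 1) ≤ T
      · simp only [hbad, hb, true_and]
        exact measureReal_lt_abs_sum_noise_le _ D _ (fun t ht ↦ by
          rw [Finset.mem_Ico] at ht
          rw [Finset.mem_range]
          omega) (by rw [Nat.card_Ico, blockStart_succ, Nat.add_sub_cancel_left]) (hn _) hL
      · simp only [hbad, hb, false_and]
        simp
        positivity
    refine (Finset.sum_le_sum fun b _ ↦ h1 b).trans (le_of_eq ?_)
    simp
  obtain ⟨i₀, hi₀⟩ : ∃ i₀, ∀ i, D.mean i ≤ D.mean i₀ := Finite.exists_max D.mean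
  have hsup : ⨆ i, D.mean i = D.mean i₀ := le_antisymm (ciSup_le hi₀) (mean_le_iSup D i₀)
  have hgap : ∀ i, D.mean i₀ - D.mean i ≤ 1 := fun i ↦ hsup ▸ iSup_mean_sub_le_one D i
  have hB0 : 0 ≤ B := by
    refine add_nonneg (Finset.sum_nonneg fun l _ ↦ ?_)
      (mul_nonneg (Nat.cast_nonneg _) (gapBound_nonneg n L m))
    exact mul_nonneg (by positivity) (gapBound_nonneg n L l)
  have hpath : ∀ᵐ h ∂P, ∑ t ∈ Finset.range T, ((⨆ i, D.mean i) - D.mean (actions h t)) ≤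
      B + Bad.indicator (fun _ ↦ (T : ℝ)) h := by
    filter_upwards [ae_actions_eliminationPolicy n L D T] with h hh
    by_cases hhB : h ∈ Bad
    · rw [Set.indicator_of_mem hhB]
      linarith [sum_gap_le D (actions h) T]
    · rw [Set.indicator_of_notMem hhB, add_zero]
      set ρ : ℕ → ℝ := fun s ↦ (extend h s).2 with hρ
      have hgood : ∀ b < m * k, blockStart k n (b + 1) ≤ T →
          |blockSum k n ρ b - n (b / k) * D.mean (blockAction n L ρ b)| ≤
            √(2 * n (b / k) * L) := by
        intro b hb hbT
        have h1 : h ∉ bad b := fun h1 ↦ hhB (Set.mem_biUnion (Finset.mem_coe.2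
          (Finset.mem_range.2 hb)) h1)
        have h2 : ∑ t ∈ Finset.Ico (blockStart k n b) (blockStart k n (b + 1)), noise D h t =
            blockSum k n ρ b - n (b / k) * D.mean (blockAction n L ρ b) := by
          unfold noise blockSum
          rw [Finset.sum_sub_distrib]
          congr 1
          calc _ = ∑ _t ∈ Finset.Ico (blockStart k n b) (blockStart k n (b + 1)),
                D.mean (blockAction n L ρ b) := by
                refine Finset.sum_congr rfl fun t ht ↦ ?_
                rw [Finset.mem_Ico] at ht
                rw [hh t (by omega), blockIndex_eq hn ht.1 ht.2]
            _ = _ := by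
                rw [Finset.sum_const, Nat.card_Ico, blockStart_succ, Nat.add_sub_cancel_left,
                  nsmul_eq_mul]
        rw [← h2]
        by_contra! h3
        exact h1 ⟨hbT, h3⟩
      refine le_trans (Finset.sum_le_sum fun t ht ↦ ?_) (sum_gapBound_le (k := k) hn L hT)
      have htT := Finset.mem_range.1 ht
      have h1 := blockStart_blockIndex_le (k := k) (n := n) t
      have h2 : blockIndex k n t / k * k ≤ blockIndex k n t := Nat.div_mul_le_self _ _
      have h3 := blockStart_mono (k := k) (n := n) h2
      have h4 : blockIndex k n t / k ≤ m := by
        by_contra! hcon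
        have h5 := blockStart_mono (k := k) (n := n) (Nat.mul_le_mul_right k hcon)
        have h6 := blockStart_epoch_add (n := n) hk m k le_rfl
        rw [show m * k + k = (m + 1) * k by ring] at h6
        have h7 : n m ≤ k * n m := Nat.le_mul_of_pos_left _ hk
        rw [Nat.succ_eq_add_one] at h5
        omega
      rw [hsup, hh t htT, blockAction]
      exact (mem_range_schedule_and_gap_le hn hi₀ hgap hgood _ h4 (by omega)).2 _
  rw [regretIn_eq_integral]
  have hind : Integrable (Bad.indicator fun _ ↦ (T : ℝ)) P := (integrable_const _).indicator hBadm
  calc _ ≤ ∫ h, (B + Bad.indicator (fun _ ↦ (T : ℝ)) h) ∂P :=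
        integral_mono_of_nonneg (.of_forall fun h ↦ sum_gap_nonneg D _ T) ((integrable_const B).add hind) hpath
    _ = B + T * P.real Bad := by
        rw [integral_add (integrable_const B) hind, integral_indicator_const _ hBadm]
        simp [mul_comm]
    _ ≤ _ := by gcongr

end

/-! ### The upper bound -/

/-- The block lengths of the epochs of the successive elimination policy: a confidence radius `√n` in one epoch
affords blocks of length `R √n` in the next, at a regret of order `R`. -/
noncomputable def epochLength (R : ℝ) : ℕ → ℕ
  | 0 => ⌈R⌉₊
  | l + 1 => ⌈R * √(epochLength R l)⌉₊

theorem one_le_epochLength {R : ℝ} (hR : 1 ≤ R) (l : ℕ) : 1 ≤ epochLength R l := by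
  induction l with
  | zero => exact Nat.one_le_ceil_iff.2 (by linarith)
  | succ l ih =>
    have h1 : (1 : ℝ) ≤ epochLength R l := by exact_mod_cast ih
    refine Nat.one_le_ceil_iff.2 (mul_pos (by linarith) (Real.sqrt_pos.2 (by linarith)))

theorem one_le_mul_sqrt_epochLength {R : ℝ} (hR : 1 ≤ R) (l : ℕ) :
    1 ≤ R * √(epochLength R l) :=
  one_le_mul_of_one_le_of_one_le hR
    (Real.one_le_sqrt.2 (by exact_mod_cast one_le_epochLength hR l))

theorem epochLength_zero_le {R : ℝ} (hR : 1 ≤ R) : (epochLength R 0 : ℝ) ≤ 2 * R := by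
  have := Nat.ceil_lt_add_one (by linarith : 0 ≤ R)
  rw [epochLength]
  linarith

theorem epochLength_succ_le {R : ℝ} (hR : 1 ≤ R) (l : ℕ) :
    (epochLength R (l + 1) : ℝ) ≤ 2 * (R * √(epochLength R l)) := by
  have h1 := one_le_mul_sqrt_epochLength hR l
  have := Nat.ceil_lt_add_one (by linarith : 0 ≤ R * √(epochLength R l : ℝ))
  rw [epochLength]
  linarith

theorem rpow_gridExponent_le_epochLength {R : ℝ} (hR : 1 ≤ R) (l : ℕ) :
    R ^ gridExponent l ≤ epochLength R l := by
  induction l with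
  | zero => rw [gridExponent_zero, Real.rpow_one]; exact Nat.le_ceil R
  | succ l ih =>
    rw [rpow_gridExponent_succ (by linarith)]
    refine le_trans ?_ (Nat.le_ceil _)
    gcongr

theorem gapBound_succ_eq {n : ℕ → ℕ} {L : ℝ} {l : ℕ} (hn : 1 ≤ n l) :
    gapBound n L (l + 1) = 4 * √(2 * L) / √(n l) := by
  have h0 : (0 : ℝ) < n l := by exact_mod_cast hn
  have h1 : √(n l : ℝ) * √(n l) = n l := Real.mul_self_sqrt h0.le
  have h2 : √(n l : ℝ) ≠ 0 := (Real.sqrt_pos.2 h0).ne'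
  rw [gapBound, show 2 * (n l : ℝ) * L = n l * (2 * L) by ring, Real.sqrt_mul h0.le,
    div_eq_div_iff h0.ne' h2]
  linear_combination (4 * √(2 * L)) * h1

/-- The regret of successive elimination with `m` epochs, with a loss that is linear in `m`. -/
theorem exists_policy_regretIn_le {k : ℕ} (hk : 2 ≤ k) {S m T : ℕ} (hS : m * (k - 1) + 1 ≤ S)
    (hT : 2 ≤ T) : ∃ π : Policy k, IsBudgetPolicy (unitCost k) S T π ∧ ∀ D : Environment k,
      regretIn π D T ≤ 50 * k * (m + 1) * (T : ℝ) ^ (1 / gridExponent m) * Real.log T := by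
  have : NeZero k := ⟨by omega⟩
  have hk2 : (2 : ℝ) ≤ k := by exact_mod_cast hk
  have hT2 : (2 : ℝ) ≤ T := by exact_mod_cast hT
  have he := one_le_gridExponent m
  set R := (T : ℝ) ^ (1 / gridExponent m) with hR
  have hR1 : 1 ≤ R := Real.one_le_rpow (by linarith) (by positivity)
  have hRT : R ^ gridExponent m = T := by
    rw [hR, ← Real.rpow_mul (by linarith), one_div_mul_cancel (by linarith), Real.rpow_one]
  have hlog : 1 / 2 ≤ Real.log T := by
    have h1 := Real.log_two_gt_d9
    have h2 := Real.log_le_log (by norm_num) hT2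
    linarith
  -- With this confidence level, the `m * k` confidence intervals fail with probability at most
  -- `2 * m * k / T ^ 2`.
  set L := 2 * Real.log T with hL
  set n : ℕ → ℕ := fun l ↦ if l < m then epochLength R l else T with hn
  have hn1 : ∀ l, 1 ≤ n l := fun l ↦ by
    simp only [hn]
    split
    · exact one_le_epochLength hR1 l
    · omega
  have hnlt : ∀ l < m, n l = epochLength R l := fun l hl ↦ if_pos hl
  have hTm : T ≤ n m := by simp [hn]
  refine ⟨eliminationPolicy k n L, isBudgetPolicy_eliminationPolicy hk hn1 L hTm hS, fun D ↦ ?_⟩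
  refine (regretIn_eliminationPolicy_le hn1 (by positivity : 0 ≤ L) hTm D).trans ?_
  set Λ := 1 + √(2 * L) with hΛ
  have hs0 : 0 ≤ √(2 * L) := Real.sqrt_nonneg _
  have hΛlog : Λ ≤ 5 * Real.log T := by
    have h1 : √(2 * L) ≤ 1 + Real.log T := by
      rw [Real.sqrt_le_left (by linarith)]
      nlinarith [sq_nonneg (Real.log T - 1)]
    linarith
  have hepoch : ∀ l < m, (k * n l : ℝ) * gapBound n L l ≤ k * (8 * R * Λ) := by
    intro l hl
    rw [mul_assoc, hnlt l hl]
    refine mul_le_mul_of_nonneg_left ?_ (by linarith)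
    match l with
    | 0 =>
      rw [gapBound, mul_one]
      have := epochLength_zero_le hR1
      nlinarith
    | l + 1 =>
      have h1 := epochLength_succ_le hR1 l
      have h2 : 0 < √(epochLength R l : ℝ) :=
        Real.sqrt_pos.2 (by exact_mod_cast one_le_epochLength hR1 l)
      rw [gapBound_succ_eq (hn1 l), hnlt l (by omega), mul_div_assoc', div_le_iff₀ h2]
      calc (epochLength R (l + 1) : ℝ) * (4 * √(2 * L))
          ≤ 2 * (R * √(epochLength R l)) * (4 * √(2 * L)) := by gcongr
        _ = 8 * R * √(2 * L) * √(epochLength R l) := by ring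
        _ ≤ 8 * R * Λ * √(epochLength R l) := by
          rw [hΛ]; gcongr; linarith
  have hlast : (T : ℝ) * gapBound n L m ≤ 4 * R * Λ := by
    rcases m with _ | m
    · rw [gridExponent_zero, Real.rpow_one] at hRT
      rw [gapBound, mul_one, ← hRT]
      nlinarith
    · have h2 : 0 < √(epochLength R m : ℝ) :=
        Real.sqrt_pos.2 (by exact_mod_cast one_le_epochLength hR1 m)
      rw [gapBound_succ_eq (hn1 m), hnlt m (by omega), mul_div_assoc', div_le_iff₀ h2, ← hRT,
        rpow_gridExponent_succ (by linarith)]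
      calc R * √(R ^ gridExponent m) * (4 * √(2 * L))
          ≤ R * √(epochLength R m) * (4 * √(2 * L)) := by
            gcongr; exact rpow_gridExponent_le_epochLength hR1 m
        _ = 4 * R * √(2 * L) * √(epochLength R m) := by ring
        _ ≤ 4 * R * Λ * √(epochLength R m) := by
          rw [hΛ]; gcongr; linarith
  have hbad : (T : ℝ) * (m * k * (2 * Real.exp (-L))) ≤ 2 * k * m * R * Λ := by
    have h1 : Real.exp (-L) = ((T : ℝ) ^ 2)⁻¹ := by
      rw [Real.exp_neg, hL, ← Real.log_rpow (by linarith), Real.exp_log (by positivity),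
        Real.rpow_two]
    rw [h1]
    have h2 : (T : ℝ) * (m * k * (2 * ((T : ℝ) ^ 2)⁻¹)) = 2 * k * m * (T : ℝ)⁻¹ := by
      field_simp
    rw [h2, mul_assoc _ R]
    gcongr
    have h3 : (T : ℝ)⁻¹ ≤ 1 := inv_le_one_of_one_le₀ (by linarith)
    nlinarith
  have hsum : ∑ l ∈ Finset.range m, (k * n l : ℝ) * gapBound n L l ≤ m * (k * (8 * R * Λ)) := by
    simpa using Finset.sum_le_card_nsmul (Finset.range m) _ _
      (fun l hl ↦ hepoch l (Finset.mem_range.1 hl))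
  have hRΛ : 0 ≤ R * Λ := by positivity
  calc _ ≤ m * (k * (8 * R * Λ)) + 4 * R * Λ + 2 * k * m * R * Λ := by gcongr
    _ ≤ 10 * k * (m + 1) * (R * Λ) := by nlinarith
    _ ≤ 10 * k * (m + 1) * (R * (5 * Real.log T)) := by gcongr
    _ = _ := by ring

/-! ### Minimax regret -/

theorem minimaxRegret_le {k S m T : ℕ} (hk : 2 ≤ k) (hS : m * (k - 1) + 1 ≤ S) (hT : 2 ≤ T) :
    minimaxRegret (unitCost k) S T ≤
      50 * k * (m + 1) * (T : ℝ) ^ (1 / gridExponent m) * Real.log T := by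
  obtain ⟨π, hπ, h⟩ := exists_policy_regretIn_le hk hS hT
  have : Nonempty (Environment k) := ⟨neutralEnvironment k⟩
  refine le_trans (ciInf_le ⟨0, ?_⟩ (⟨π, hπ⟩ : {π : Policy k // IsBudgetPolicy (unitCost k) S T π}))
    (ciSup_le h)
  rintro _ ⟨π, rfl⟩
  exact Real.iSup_nonneg fun D ↦ (regretIn_mem_Icc (by omega) π.1 D T).1

theorem le_minimaxRegret {k S T : ℕ} (hk : 2 ≤ k) (hS : 1 ≤ S) (hT : 2 ≤ T) {x : ℝ}
    (h : ∀ π : Policy k, IsBudgetPolicy (unitCost k) S T π → x ≤ regret π T) :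
    x ≤ minimaxRegret (unitCost k) S T := by
  obtain ⟨π, hπ, -⟩ := exists_policy_regretIn_le hk (m := 0) (by omega : 0 * (k - 1) + 1 ≤ S) hT
  have : Nonempty {π : Policy k // IsBudgetPolicy (unitCost k) S T π} := ⟨⟨π, hπ⟩⟩
  exact le_ciInf fun π ↦ h π.1 π.2

theorem phaseIndex_mul_add_one_le {k S : ℕ} (hk : 2 ≤ k) (hS : 1 ≤ S) :
    phaseIndex k S * (k - 1) + 1 ≤ S := by
  have hk2 : (2 : ℝ) ≤ k := by exact_mod_cast hk
  have hS1 : (1 : ℝ) ≤ S := by exact_mod_cast hS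
  have h := Nat.floor_le (div_nonneg (by linarith) (by linarith) :
    0 ≤ ((S : ℝ) - 1) / ((k : ℝ) - 1))
  rw [le_div_iff₀ (by linarith)] at h
  have h1 : (phaseIndex k S : ℝ) * (k - 1 : ℕ) + 1 ≤ S := by
    rw [Nat.cast_sub (by omega)]
    push_cast
    unfold phaseIndex
    linarith
  exact_mod_cast h1

theorem le_phaseIndex_add_one_mul {k S : ℕ} (hk : 2 ≤ k) :
    S ≤ (phaseIndex k S + 1) * (k - 1) := by
  have hk2 : (2 : ℝ) ≤ k := by exact_mod_cast hk
  have h := Nat.lt_floor_add_one (((S : ℝ) - 1) / ((k : ℝ) - 1))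
  rw [div_lt_iff₀ (by linarith)] at h
  have h1 : (S : ℝ) < (phaseIndex k S + 1) * (k - 1 : ℕ) + 1 := by
    rw [Nat.cast_sub (by omega)]
    push_cast
    unfold phaseIndex
    linarith
  exact Nat.lt_succ_iff.1 (by exact_mod_cast h1)

/-- After `log₂ log₂ T` epochs the regret is of order `√T`, so that further epochs do not help. -/
theorem rpow_one_div_gridExponent_le_sqrt {m T : ℕ} (hT : 1 ≤ T)
    (hm : Real.log T / Real.log 2 ≤ 2 ^ m) : (T : ℝ) ^ (1 / gridExponent m) ≤ 2 * √T := by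
  have hT1 : (1 : ℝ) ≤ T := by exact_mod_cast hT
  have hx0 : (0 : ℝ) < 2 ^ m := by positivity
  have hx1 : (1 : ℝ) ≤ 2 ^ m := one_le_pow₀ (by norm_num)
  have he : gridExponent m = 2 - ((2 : ℝ) ^ m)⁻¹ := by
    rw [gridExponent, Real.rpow_neg (by norm_num), Real.rpow_natCast]
  have hy1 : ((2 : ℝ) ^ m)⁻¹ ≤ 1 := inv_le_one_of_one_le₀ hx1
  have hy0 : 0 < ((2 : ℝ) ^ m)⁻¹ := by positivity
  have h1 : 1 / gridExponent m ≤ 1 / 2 + ((2 : ℝ) ^ m)⁻¹ := by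
    rw [he, div_le_iff₀ (by linarith)]
    nlinarith
  have hlog2 : 0 < Real.log 2 := Real.log_pos (by norm_num)
  have h2 : (T : ℝ) ^ ((2 : ℝ) ^ m)⁻¹ ≤ 2 := by
    rw [Real.rpow_def_of_pos (by linarith), ← Real.le_log_iff_exp_le (by norm_num)]
    rw [div_le_iff₀ hlog2] at hm
    rw [mul_inv_le_iff₀ hx0]
    linarith
  calc (T : ℝ) ^ (1 / gridExponent m) ≤ (T : ℝ) ^ (1 / 2 + ((2 : ℝ) ^ m)⁻¹) :=
        Real.rpow_le_rpow_of_exponent_le hT1 h1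
    _ = √T * (T : ℝ) ^ ((2 : ℝ) ^ m)⁻¹ := by
      rw [Real.rpow_add (by linarith), Real.sqrt_eq_rpow]
    _ ≤ √T * 2 := by gcongr
    _ = 2 * √T := mul_comm _ _

theorem sqrt_le_rpow_one_div_gridExponent {m T : ℕ} (hT : 1 ≤ T) :
    √(T : ℝ) ≤ (T : ℝ) ^ (1 / gridExponent m) := by
  rw [Real.sqrt_eq_rpow]
  refine Real.rpow_le_rpow_of_exponent_le (by exact_mod_cast hT) ?_
  exact one_div_le_one_div_of_le (by linarith [one_le_gridExponent m]) (gridExponent_le_two m)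

theorem half_le_log {T : ℕ} (hT : 2 ≤ T) : 1 / 2 ≤ Real.log T := by
  have h1 := Real.log_two_gt_d9
  have h2 := Real.log_le_log (by norm_num) (by exact_mod_cast hT : (2 : ℝ) ≤ T)
  linarith

theorem add_one_le_two_mul_log {m T : ℕ} (hT : 2 ≤ T)
    (hm : (2 : ℝ) ^ m < Real.log T / Real.log 2) : (m : ℝ) + 1 ≤ 2 * Real.log T := by
  have h1 := Real.log_two_gt_d9
  have h2 := half_le_log hT
  have h3 : (m : ℝ) + 1 ≤ 2 ^ m := by exact_mod_cast Nat.lt_two_pow_self (n := m)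
  rw [lt_div_iff₀ (by linarith)] at hm
  nlinarith

theorem minimaxRegret_lower {k S T : ℕ} (hk : 2 ≤ k) (hS : 1 ≤ S) (hT : 2 ≤ T) :
    1 / (6144 * (k : ℝ) ^ 2) * (T : ℝ) ^ regretExponent k S / Real.log T ^ 4 ≤
      minimaxRegret (unitCost k) S T := by
  have : NeZero k := ⟨by omega⟩
  have hk0 : (0 : ℝ) < k := by exact_mod_cast (by omega : 0 < k)
  have hlog := half_le_log hT
  refine le_minimaxRegret hk hS hT fun π hπ ↦ ?_
  change 1 / (6144 * (k : ℝ) ^ 2) * (T : ℝ) ^ (1 / gridExponent (phaseIndex k S)) / _ ≤ _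
  set m := phaseIndex k S
  set R := (T : ℝ) ^ (1 / gridExponent m)
  have hR : 0 ≤ R := by positivity
  rcases le_or_gt (Real.log T / Real.log 2) (2 ^ m) with h | h
  · refine le_trans ?_ (sqrt_le_regret hk π (by omega))
    have h1 : R ≤ 2 * √T := rpow_one_div_gridExponent_le_sqrt (by omega) h
    have h2 : (1 / 2 : ℝ) ^ 4 ≤ Real.log T ^ 4 := by gcongr
    rw [div_le_iff₀ (by positivity)]
    calc 1 / (6144 * (k : ℝ) ^ 2) * R ≤ 1 / (6144 * (k : ℝ) ^ 2) * (2 * √T) := by gcongr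
      _ = √T / (12 * k ^ 2) * (1 / 256) := by field_simp; norm_num
      _ ≤ √T / (12 * k ^ 2) * (1 / 2) ^ 4 := by gcongr; norm_num
      _ ≤ _ := by gcongr
  · refine le_trans ?_ (rpow_div_le_regret hk π hπ (le_phaseIndex_add_one_mul hk) (by omega))
    have h1 := add_one_le_two_mul_log hT h
    have h2 : (m : ℝ) + 2 ≤ 4 * Real.log T := by linarith
    have h3 : ((m : ℝ) + 2) ^ 4 ≤ (4 * Real.log T) ^ 4 := by gcongr
    calc 1 / (6144 * (k : ℝ) ^ 2) * R / Real.log T ^ 4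
        = R / (24 * k ^ 2 * (4 * Real.log T) ^ 4) := by field_simp; ring
      _ ≤ _ := by gcongr

theorem minimaxRegret_upper {k S T : ℕ} (hk : 2 ≤ k) (hS : 1 ≤ S) (hT : 2 ≤ T) :
    minimaxRegret (unitCost k) S T ≤
      1600 * k * (T : ℝ) ^ regretExponent k S * Real.log T ^ 4 := by
  have hk0 : (0 : ℝ) < k := by exact_mod_cast (by omega : 0 < k)
  have hlog := half_le_log hT
  change _ ≤ 1600 * (k : ℝ) * (T : ℝ) ^ (1 / gridExponent (phaseIndex k S)) * _
  have hm := phaseIndex_mul_add_one_le hk hS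
  set m := phaseIndex k S
  set R := (T : ℝ) ^ (1 / gridExponent m)
  have hR : 0 ≤ R := by positivity
  -- Beyond the first `m'` with `log₂ T ≤ 2 ^ m'`, further epochs only increase the factor `m + 1`.
  obtain ⟨m', hm', hlen, hrate⟩ : ∃ m' ≤ m, (m' : ℝ) + 1 ≤ 4 * Real.log T ∧
      (T : ℝ) ^ (1 / gridExponent m') ≤ 2 * R := by
    classical
    by_cases h : ∃ m', m' ≤ m ∧ Real.log T / Real.log 2 ≤ 2 ^ m'
    · refine ⟨Nat.find h, (Nat.find_spec h).1, ?_, ?_⟩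
      · rcases hf : Nat.find h with _ | j
        · push_cast
          linarith
        · have h1 := Nat.find_min h (m := j) (by omega)
          have h2 := (Nat.find_spec h).1
          push Not at h1
          have h3 := add_one_le_two_mul_log hT (h1 (by omega))
          push_cast
          linarith
      · exact (rpow_one_div_gridExponent_le_sqrt (by omega) (Nat.find_spec h).2).trans
          (by gcongr; exact sqrt_le_rpow_one_div_gridExponent (by omega))
    · push Not at h
      exact ⟨m, le_rfl, by linarith [add_one_le_two_mul_log hT (h m le_rfl)], by linarith⟩
  refine (minimaxRegret_le hk (m := m') ?_ hT).trans ?_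
  · exact le_trans (by gcongr) hm
  · have h1 : (1 / 2 : ℝ) ^ 2 ≤ Real.log T ^ 2 := by gcongr
    calc 50 * k * ((m' : ℝ) + 1) * (T : ℝ) ^ (1 / gridExponent m') * Real.log T
        ≤ 50 * k * (4 * Real.log T) * (2 * R) * Real.log T := by gcongr
      _ = 1600 * k * R * Real.log T ^ 2 * (1 / 2) ^ 2 := by ring
      _ ≤ 1600 * k * R * Real.log T ^ 2 * Real.log T ^ 2 := by gcongr
      _ = _ := by ring

end BwSC

theorem corollary1 (k : ℕ) (hk : 2 ≤ k) :
    ∃ c C : ℝ, ∃ p : ℕ, 0 < c ∧ 0 < C ∧ ∀ S : ℕ, 1 ≤ S → ∀ T : ℕ, k ≤ T →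
      c * (T : ℝ) ^ BwSC.regretExponent k S / Real.log T ^ p ≤
          BwSC.minimaxRegret (BwSC.unitCost k) S T ∧
        BwSC.minimaxRegret (BwSC.unitCost k) S T ≤
          C * (T : ℝ) ^ BwSC.regretExponent k S * Real.log T ^ p := by
  have hk0 : (0 : ℝ) < k := by exact_mod_cast (by omega : 0 < k)
  exact ⟨1 / (6144 * (k : ℝ) ^ 2), 1600 * k, 4, by positivity, by positivity, fun S hS T hT ↦
    ⟨BwSC.minimaxRegret_lower hk hS (hk.trans hT), BwSC.minimaxRegret_upper hk hS (hk.trans hT)⟩⟩
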